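/- Let $n\ge 0$, let $\Delta GL(n,\mathbb{R})=\left\{\begin{pmatrix}A&0\\0&A\end{pmatrix}: A\in GL(n,\mathbb{R})\right\}\subset GL(2n,\mathbb{R})$ and $\Delta_*\mathfrak{gl}(n,\mathbb{R})=\left\{\begin{pmatrix}A&0\\0&A\end{pmatrix}: A\in \mathfrak{gl}(n,\mathbb{R})\right\}$, which is the Lie algebra of $\Delta GL(n,\mathbb{R})$, i.e. the set of $2n\times 2n$ matrices $X$ with $\exp(tX)\in\Delta GL(n,\mathbb{R})$ for all $t\in\mathbb{R}$. For a Lie subalgebra $\mathfrak{g}\subset\mathfrak{gl}(m,\mathbb{R})$ let $\mathfrak{g}^{(1)}=\{T\in\mathrm{Hom}(\mathbb{R}^m,\mathfrak{g}): T(u)v-T(v)u=0\ \ \forall u,v\in\mathbb{R}^m\}$ be its first prolongation. Then $$\bigl(\Delta_*\mathfrak{gl}(n,\mathbb{R})\bigr)^{(1)}=0,$$ and $\Delta_*\mathfrak{gl}(n,\mathbb{R})$ is invariant under transposition. Moreover, let $M$ be a smooth ($C^\infty$, Hausdorff, second countable) manifold of dimension $2n$. (a) Let $(F,P)$ be an almost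 biparacomplex structure on $M$, i.e. a pair of smooth $(1,1)$-tensor fields with $F^2=P^2=\mathrm{Id}$ and $F\circ P+P\circ F=0$. Its adapted frames, i.e. the frames $(X_1,\dots,X_n,PX_1,\dots,PX_n)$ with $FX_i=X_i$, form a smooth $\Delta GL(n,\mathbb{R})$-structure on $M$. (b) For every $\Delta GL(n,\mathbb{R})$-structure $\mathcal{B}\to M$ (in particular for that of any almost biparacomplex structure) the well-adapted connection exists: there is a unique smooth linear connection $\nabla'$ on $M$ such that $\nabla'$ is adapted to $\mathcal{B}$ (in every smooth local frame belonging to $\mathcal{B}$ its connection form takes values in $\Delta_*\mathfrak{gl}(n,\mathbb{R})$) and $$\mathrm{trace}(S\circ i_X\circ T')=0$$ for every smooth vector field $X$ on $M$ and every smooth section $S$ of the adjoint bundle $\mathrm{ad}\,\mathcal{B}\subset\mathrm{End}(TM)$, where $T'$ is the torsion of $\nabla'$, $(i_X\circ T')(Y)=T'(X,Y)$, and the fibre of $\mathrm{ad}\,\mathcal{B}$ at $x$ consists of the endomorphisms of $T_xM$ whose matrix in a frame of $\mathcal{B}_x$ lies in $\Delta_*\mathfrak{gl}(n,\mathbb{R})$.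 (c) This connection depends only on the first contact of the structure: if two $\Delta GL(n,\mathbb{R})$-structures $\mathcal{B},\bar{\mathcal{B}}$ on $M$ have the same first contact at $x\in M$ (there are smooth local sections of $\mathcal{B}$ and $\bar{\mathcal{B}}$ near $x$ with the same value and the same derivative at $x$, i.e. the corresponding sections of $FM/\Delta GL(n,\mathbb{R})$ have the same 1-jet at $x$), then their well-adapted connections coincide at $x$. -/

import Mathlib

open scoped Manifold ContDiff Matrix

noncomputable section

attribute [local instance] LieRing.ofAssociativeRing

/-! ### Linear algebra: the group `ΔGL(n, ℝ)`, its Lie algebra, first prolongations -/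

section LinearAlgebra

/-- The diagonal embedding `A ↦ diag(A, A)` of `n × n` matrices into `2n × 2n` matrices. -/
def deltaHom (n : ℕ) :
    Matrix (Fin n) (Fin n) ℝ →ₐ[ℝ] Matrix (Fin n ⊕ Fin n) (Fin n ⊕ Fin n) ℝ :=
  AlgHom.ofLinearMap
    { toFun := fun A => Matrix.fromBlocks A 0 0 A
      map_add' := fun A B => by simp [Matrix.fromBlocks_add]
      map_smul' := fun c A => by simp [Matrix.fromBlocks_smul] }
    (by simp [Matrix.fromBlocks_one])
    (fun A B => by simp [Matrix.fromBlocks_multiply])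

/-- The Lie group `ΔGL(n, ℝ) = {diag(A, A) : A ∈ GL(n, ℝ)}`. -/
def deltaGL (n : ℕ) : Subgroup (Matrix.GeneralLinearGroup (Fin n ⊕ Fin n) ℝ) :=
  (Units.map (deltaHom n : Matrix (Fin n) (Fin n) ℝ →* _)).range

/-- The matrix Lie algebra `Δ_*gl(n, ℝ) = {diag(A, A) : A ∈ gl(n, ℝ)}`. -/
def deltaLie (n : ℕ) : LieSubalgebra ℝ (Matrix (Fin n ⊕ Fin n) (Fin n ⊕ Fin n) ℝ) :=
  (deltaHom n).toLieHom.range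

variable {ι : Type*} [Fintype ι] [DecidableEq ι]

/-- `𝔤` is the Lie algebra of the (closed) matrix group `G`: it consists of the matrices
generating a one-parameter subgroup contained in `G`. -/
def IsLieAlgebraOf (𝔤 : LieSubalgebra ℝ (Matrix ι ι ℝ))
    (G : Subgroup (Matrix.GeneralLinearGroup ι ℝ)) : Prop :=
  ∀ A : Matrix ι ι ℝ, A ∈ 𝔤 ↔
    ∀ t : ℝ, ∃ g ∈ G, (g : Matrix ι ι ℝ) = NormedSpace.exp (t • A)

/-- The first prolongation
`𝔤⁽¹⁾ = {T ∈ Hom(ℝ^m, 𝔤) : T(u) v - T(v) u = 0 for all u, v}`. -/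
def firstProlongation (𝔤 : LieSubalgebra ℝ (Matrix ι ι ℝ)) :
    Submodule ℝ ((ι → ℝ) →ₗ[ℝ] 𝔤) where
  carrier := {T | ∀ u v : ι → ℝ,
    (T u : Matrix ι ι ℝ) *ᵥ v - (T v : Matrix ι ι ℝ) *ᵥ u = 0}
  zero_mem' := fun u v => by simp
  add_mem' := fun {S T} hS hT u v => by
    have h := congrArg₂ (· + ·) (hS u v) (hT u v)
    simp only [add_zero] at h
    rw [← h]
    change ((S u : Matrix ι ι ℝ) + (T u : Matrix ι ι ℝ)) *ᵥ v -
      ((S v : Matrix ι ι ℝ) + (T v : Matrix ι ι ℝ)) *ᵥ u = _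
    rw [Matrix.add_mulVec, Matrix.add_mulVec, add_sub_add_comm]
  smul_mem' := fun c T hT u v => by
    have h := congrArg (c • ·) (hT u v)
    simp only [smul_zero] at h
    rw [← h]
    change (c • (T u : Matrix ι ι ℝ)) *ᵥ v - (c • (T v : Matrix ι ι ℝ)) *ᵥ u = _
    rw [Matrix.smul_mulVec, Matrix.smul_mulVec, smul_sub]

end LinearAlgebra

/-! ### `G`-structures, adapted connections, the well-adapted connection -/

section Geometry

variable {E : Type*} [NormedAddCommGroup E] [NormedSpace ℝ E]
  (M : Type*) [TopologicalSpace M] [ChartedSpace E M]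

/-- A family of linear frames: a set `B x` of bases of `T_x M` for each `x`, i.e. a subset of the
bundle `FM` of linear frames. -/
abbrev FrameFamily (E : Type*) [NormedAddCommGroup E] [NormedSpace ℝ E]
    (M : Type*) [TopologicalSpace M] [ChartedSpace E M] (ι : Type*) : Type _ :=
  ∀ x : M, Set (Module.Basis ι ℝ (TangentSpace 𝓘(ℝ, E) x))

variable {M} {ι : Type*}

/-- The frame field `e` is a smooth local section of `B` over `U`. -/
def IsLocalSection (B : FrameFamily E M ι) (U : Set M)
    (e : ι → Π x : M, TangentSpace 𝓘(ℝ, E) x) [IsManifold 𝓘(ℝ, E) ∞ M] : Prop :=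
  (∀ i, ContMDiffOn 𝓘(ℝ, E) 𝓘(ℝ, E).tangent ∞
    (fun x => (⟨x, e i x⟩ : TangentBundle 𝓘(ℝ, E) M)) U) ∧
  ∀ x ∈ U, ∃ b ∈ B x, ∀ i, b i = e i x

variable [Fintype ι] [DecidableEq ι] [IsManifold 𝓘(ℝ, E) ∞ M]

/-- `B` is a (smooth) `G`-structure: a reduction of the frame bundle to the group `G`.
Matrices act on frames from the right by `(b · g)_j = ∑ i, g_ij b_i`; the fibres of `B` are
`G`-orbits, and `B` has smooth local sections near every point. -/
structure IsGStructure (G : Subgroup (Matrix.GeneralLinearGroup ι ℝ))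
    (B : FrameFamily E M ι) : Prop where
  orbit : ∀ x, ∀ b ∈ B x, ∀ b' : Module.Basis ι ℝ (TangentSpace 𝓘(ℝ, E) x),
    b' ∈ B x ↔ ∃ g ∈ G, ∀ j, b' j = ∑ i, (g : Matrix ι ι ℝ) i j • b i
  exists_localSection : ∀ x : M, ∃ U : Set M, IsOpen U ∧ x ∈ U ∧
    ∃ e : ι → Π y : M, TangentSpace 𝓘(ℝ, E) y, IsLocalSection B U e

/-- `B` and `B'` have the same first contact at `x`, i.e. the corresponding sections of `FM/G`
have the same 1-jet at `x`: they have smooth local sections with equal values and equal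
derivatives at `x`. -/
def SameFirstContact (B B' : FrameFamily E M ι) (x : M) : Prop :=
  ∃ U : Set M, IsOpen U ∧ x ∈ U ∧
    ∃ e e' : ι → Π y : M, TangentSpace 𝓘(ℝ, E) y,
      IsLocalSection B U e ∧ IsLocalSection B' U e' ∧
      ∀ i, e i x = e' i x ∧
        mfderiv 𝓘(ℝ, E) 𝓘(ℝ, E).tangent
            (fun y => (⟨y, e i y⟩ : TangentBundle 𝓘(ℝ, E) M)) x =
          mfderiv 𝓘(ℝ, E) 𝓘(ℝ, E).tangent
            (fun y => (⟨y, e' i y⟩ : TangentBundle 𝓘(ℝ, E) M)) x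

/-- The fibre at `x` of the adjoint bundle `ad B = (B × 𝔤)/G`, seen inside `End(T_x M)`: the
endomorphisms whose matrix in some frame of `B x` lies in `𝔤`. -/
def adjointFibre (𝔤 : LieSubalgebra ℝ (Matrix ι ι ℝ)) (B : FrameFamily E M ι) (x : M) :
    Set (TangentSpace 𝓘(ℝ, E) x →L[ℝ] TangentSpace 𝓘(ℝ, E) x) :=
  {S | ∃ b ∈ B x, LinearMap.toMatrix b b (S : TangentSpace 𝓘(ℝ, E) x →ₗ[ℝ] _) ∈ 𝔤}

/-- A field of endomorphisms of the tangent spaces is smooth, i.e. is a smooth tensor field of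
type `(1,1)`. -/
def IsSmoothEndomorphism
    (S : Π x : M, TangentSpace 𝓘(ℝ, E) x →L[ℝ] TangentSpace 𝓘(ℝ, E) x) : Prop :=
  ContMDiff 𝓘(ℝ, E) (𝓘(ℝ, E).prod 𝓘(ℝ, E →L[ℝ] E)) ∞
    (fun x => (⟨x, S x⟩ : Bundle.TotalSpace (E →L[ℝ] E)
      fun x : M => TangentSpace 𝓘(ℝ, E) x →L[ℝ] TangentSpace 𝓘(ℝ, E) x))

/-- The linear connections on `M` (covariant derivatives on `TM`; `cov Y x v` is `∇_v Y`). -/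
abbrev LinearConnection (E : Type*) [NormedAddCommGroup E] [NormedSpace ℝ E]
    (M : Type*) [TopologicalSpace M] [ChartedSpace E M] [IsManifold 𝓘(ℝ, E) ∞ M] : Type _ :=
  CovariantDerivative 𝓘(ℝ, E) E (TangentSpace 𝓘(ℝ, E) : M → Type _)

/-- The connection `cov` is adapted to (reducible to) `B`: in every smooth local frame belonging
to `B`, its connection form `W`, given by `∇_v e_j = ∑ i, W_ij(v) e_i`, takes values in `𝔤`. -/
def IsAdapted (𝔤 : LieSubalgebra ℝ (Matrix ι ι ℝ)) (B : FrameFamily E M ι)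
    (cov : LinearConnection E M) : Prop :=
  ∀ (U : Set M) (e : ι → Π x : M, TangentSpace 𝓘(ℝ, E) x), IsOpen U → IsLocalSection B U e →
    ∀ x ∈ U, ∀ v : TangentSpace 𝓘(ℝ, E) x, ∃ W ∈ 𝔤, ∀ j,
      cov (e j) x v = ∑ i, W i j • e i x

/-- `cov` is a well-adapted connection of the `G`-structure `B`, `𝔤` being the Lie algebra of `G`:
a smooth linear connection adapted to `B` whose torsion `T` satisfies
`trace (S ∘ i_X ∘ T) = 0` for all smooth sections `S` of the adjoint bundle and all smooth vector
fields `X`. -/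
structure IsWellAdapted [FiniteDimensional ℝ E] [CompleteSpace E]
    (𝔤 : LieSubalgebra ℝ (Matrix ι ι ℝ)) (B : FrameFamily E M ι)
    (cov : LinearConnection E M) : Prop where
  smooth : cov.ContMDiffCovariantDerivative ∞
  adapted : IsAdapted 𝔤 B cov
  trace_eq_zero :
    ∀ S : Π x : M, TangentSpace 𝓘(ℝ, E) x →L[ℝ] TangentSpace 𝓘(ℝ, E) x,
      IsSmoothEndomorphism S → (∀ x, S x ∈ adjointFibre 𝔤 B x) →
    ∀ X : Π x : M, TangentSpace 𝓘(ℝ, E) x,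
      ContMDiff 𝓘(ℝ, E) 𝓘(ℝ, E).tangent ∞
        (fun x => (⟨x, X x⟩ : TangentBundle 𝓘(ℝ, E) M)) →
    ∀ x, LinearMap.trace ℝ (TangentSpace 𝓘(ℝ, E) x)
      ((S x ∘L cov.torsion x (X x) :
        TangentSpace 𝓘(ℝ, E) x →L[ℝ] TangentSpace 𝓘(ℝ, E) x) :
        TangentSpace 𝓘(ℝ, E) x →ₗ[ℝ] TangentSpace 𝓘(ℝ, E) x) = 0

/-- Two covariant derivatives are equal at `x` as linear connections: they agree on all vector
fields that are differentiable at `x`. (The values of a `CovariantDerivative` on vector fields that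
are not differentiable at `x` carry no meaning.) -/
def ConnectionEqAt (cov cov' : LinearConnection E M) (x : M) : Prop :=
  ∀ Y : Π x : M, TangentSpace 𝓘(ℝ, E) x,
    MDifferentiableAt 𝓘(ℝ, E) 𝓘(ℝ, E).tangent
      (fun y => (⟨y, Y y⟩ : TangentBundle 𝓘(ℝ, E) M)) x →
    cov Y x = cov' Y x

/-! ### Almost biparacomplex structures -/

/-- An almost biparacomplex structure: smooth tensor fields `F`, `P` of type `(1,1)` with
`F² = P² = Id` and `F ∘ P + P ∘ F = 0`. -/
structure AlmostBiparacomplex (E : Type*) [NormedAddCommGroup E] [NormedSpace ℝ E]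
    (M : Type*) [TopologicalSpace M] [ChartedSpace E M] [IsManifold 𝓘(ℝ, E) ∞ M] where
  F : Π x : M, TangentSpace 𝓘(ℝ, E) x →L[ℝ] TangentSpace 𝓘(ℝ, E) x
  P : Π x : M, TangentSpace 𝓘(ℝ, E) x →L[ℝ] TangentSpace 𝓘(ℝ, E) x
  smooth_F : IsSmoothEndomorphism F
  smooth_P : IsSmoothEndomorphism P
  F_sq : ∀ x v, F x (F x v) = v
  P_sq : ∀ x v, P x (P x v) = v
  anticomm : ∀ x v, F x (P x v) + P x (F x v) = 0

/-- The frames `(X_1, …, X_n, Y_1, …, Y_n)` adapted to `(F, P)`: `(X_i)` is a basis of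
`T_F^+ = ker (F - Id)` and `Y_i = P X_i` (so that `F Y_i = -Y_i`). -/
def AlmostBiparacomplex.adaptedFrames (A : AlmostBiparacomplex E M) (n : ℕ) :
    FrameFamily E M (Fin n ⊕ Fin n) :=
  fun x => {b | ∀ i : Fin n, A.F x (b (Sum.inl i)) = b (Sum.inl i) ∧
    A.P x (b (Sum.inl i)) = b (Sum.inr i)}

end Geometry

end

open scoped Manifold ContDiff Matrix

noncomputable section

attribute [local instance] LieRing.ofAssociativeRing

/-! ### The Lie algebra `Δ_*gl(n, ℝ)` -/

section DeltaLie

open Matrix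

variable {n : ℕ}

/-! Fix a local frame `e` of the structure and write `∇_{e_k} e_j = ∑ i, (W_k)_ij e_i` with every
`W_k` in `𝔤 = deltaLie n`. With structure functions `[e_k, e_j] = ∑ i, (C_k)_ij e_i`, the trace
condition becomes the linear system `tr (A (∂W_k - C_k)) = 0` for all `A ∈ 𝔤` and all `k`, where `∂`
is `alternation` (`toMatrix_torsion`).

This system is uniquely solvable. If `C = 0`, then `A = W_kᵀ` is allowed because `𝔤` is invariant
under transposition, and summing over `k` gives `½ |∂W|² = 0`. So `∂W = 0`, that is, `W` lies in the
first prolongation, which vanishes. The system is thus injective between spaces of equal dimension,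
and its solution is a linear function of `C` (`eq_zero_of_trace_mul_alternation_eq_zero`,
`exists_linear_solution`).

Both the adaptedness and the trace condition are independent of the frame chosen in the structure.
The local solutions are therefore connections that agree on overlaps, and uniqueness yields both a
global connection and its smoothness (`contMDiff_gluedConnection`). At a point only the value and
first derivative of a frame enter, which gives the dependence on first contact
(`connectionEqAt_of_sameFirstContact`).

For biparacomplex structures, applying `(1 + F)/2` to extended vectors and then `P` produces adapted
frames. -/

theorem mem_deltaLie_iff {A : Matrix (Fin n ⊕ Fin n) (Fin n ⊕ Fin n) ℝ} :
    A ∈ deltaLie n ↔ ∃ a : Matrix (Fin n) (Fin n) ℝ, fromBlocks a 0 0 a = A :=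
  Iff.rfl

theorem mem_deltaLie_iff_entries {A : Matrix (Fin n ⊕ Fin n) (Fin n ⊕ Fin n) ℝ} :
    A ∈ deltaLie n ↔ ∀ i j, A (.inl i) (.inl j) = A (.inr i) (.inr j) ∧
      A (.inl i) (.inr j) = 0 ∧ A (.inr i) (.inl j) = 0 := by
  rw [mem_deltaLie_iff]
  constructor
  · rintro ⟨a, rfl⟩ i j
    simp
  · intro h
    refine ⟨A.toBlocks₁₁, ?_⟩
    ext (i | i) (j | j) <;> simp [toBlocks₁₁, h i j]

/-- This Lie algebra is even an associative algebra, so changes of frame can be handled by products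
of its elements, without the adjoint action. -/
theorem mul_mem_deltaLie {A B : Matrix (Fin n ⊕ Fin n) (Fin n ⊕ Fin n) ℝ}
    (hA : A ∈ deltaLie n) (hB : B ∈ deltaLie n) : A * B ∈ deltaLie n := by
  obtain ⟨a, rfl⟩ := mem_deltaLie_iff.1 hA
  obtain ⟨b, rfl⟩ := mem_deltaLie_iff.1 hB
  exact mem_deltaLie_iff.2 ⟨a * b, by simp [fromBlocks_multiply]⟩

theorem transpose_mem_deltaLie {A : Matrix (Fin n ⊕ Fin n) (Fin n ⊕ Fin n) ℝ}
    (hA : A ∈ deltaLie n) : Aᵀ ∈ deltaLie n := by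
  obtain ⟨a, rfl⟩ := mem_deltaLie_iff.1 hA
  exact mem_deltaLie_iff.2 ⟨aᵀ, by simp [fromBlocks_transpose]⟩

/-- Since `det diag(a, a) = (det a)²`, invertibility of the big matrix forces that of `a`.
Membership in the group is thus a linear condition on the entries. -/
theorem mem_deltaGL_iff {g : GeneralLinearGroup (Fin n ⊕ Fin n) ℝ} :
    g ∈ deltaGL n ↔ (g : Matrix (Fin n ⊕ Fin n) (Fin n ⊕ Fin n) ℝ) ∈ deltaLie n := by
  constructor
  · rintro ⟨a, rfl⟩
    exact ⟨a, rfl⟩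
  · intro h
    obtain ⟨a, ha⟩ := mem_deltaLie_iff.1 h
    have hdet : IsUnit a.det := by
      have h1 : IsUnit (g : Matrix (Fin n ⊕ Fin n) (Fin n ⊕ Fin n) ℝ).det :=
        (isUnit_iff_isUnit_det _).1 g.isUnit
      rw [← ha, det_fromBlocks_zero₂₁] at h1
      exact isUnit_of_mul_isUnit_left h1
    refine ⟨((isUnit_iff_isUnit_det a).2 hdet).unit, Units.ext ?_⟩
    exact ha

/-- The exponential commutes with the continuous algebra map `deltaHom n`. Conversely, `A` is the
derivative at `0` of `exp (t • A)`, a limit of difference quotients in a closed subspace. -/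
theorem isLieAlgebraOf_deltaLie_deltaGL : IsLieAlgebraOf (deltaLie n) (deltaGL n) := by
  let _ : NormedRing (Matrix (Fin n) (Fin n) ℝ) := Matrix.linftyOpNormedRing
  let _ : NormedAlgebra ℝ (Matrix (Fin n) (Fin n) ℝ) := Matrix.linftyOpNormedAlgebra
  let _ : NormedRing (Matrix (Fin n ⊕ Fin n) (Fin n ⊕ Fin n) ℝ) := Matrix.linftyOpNormedRing
  let _ : NormedAlgebra ℝ (Matrix (Fin n ⊕ Fin n) (Fin n ⊕ Fin n) ℝ) :=
    Matrix.linftyOpNormedAlgebra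
  let _ : NormedAlgebra ℚ (Matrix (Fin n) (Fin n) ℝ) := NormedAlgebra.restrictScalars ℚ ℝ _
  intro A
  constructor
  · intro hA t
    obtain ⟨a, rfl⟩ := mem_deltaLie_iff.1 hA
    have hcont : Continuous (deltaHom n) :=
      (deltaHom n).toLinearMap.continuous_of_finiteDimensional
    have hexp : deltaHom n (NormedSpace.exp (t • a)) =
        NormedSpace.exp (t • fromBlocks a 0 0 a) := by
      have h := NormedSpace.map_exp (deltaHom n) hcont (t • a)
      rw [map_smul] at h
      exact h
    refine ⟨(Matrix.isUnit_exp (t • fromBlocks a 0 0 a)).unit, ?_, rfl⟩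
    rw [mem_deltaGL_iff]
    exact ⟨_, hexp⟩
  · intro h
    have hd := hasDerivAt_exp_smul_const (𝕂 := ℝ) A 0
    have hmem : ∀ t : ℝ, NormedSpace.exp (t • A) ∈ (deltaLie n).toSubmodule := by
      intro t
      obtain ⟨g, hg, hgt⟩ := h t
      rw [← hgt]
      exact mem_deltaGL_iff.1 hg
    have hclosed : IsClosed ((deltaLie n).toSubmodule :
        Set (Matrix (Fin n ⊕ Fin n) (Fin n ⊕ Fin n) ℝ)) :=
      (deltaLie n).toSubmodule.closed_of_finiteDimensional
    have h0 := hd.tendsto_slope_zero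
    have := hclosed.mem_of_tendsto h0 (Filter.Eventually.of_forall fun t =>
      (deltaLie n).toSubmodule.smul_mem _ ((deltaLie n).toSubmodule.sub_mem (hmem _) (hmem _)))
    simpa using this

/-- If `T (u, 0) = diag(a, a)` and `T (0, w) = diag(b, b)`, symmetry reads `(0, a w) = (b u, 0)`, so
`a w = 0` for every `w`. The two copies of `ℝⁿ` kill each other's contribution. -/
theorem firstProlongation_deltaLie : firstProlongation (deltaLie n) = ⊥ := by
  rw [eq_bot_iff]
  intro T hT
  have hT' : ∀ u v : Fin n ⊕ Fin n → ℝ, 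
      (T u : Matrix (Fin n ⊕ Fin n) (Fin n ⊕ Fin n) ℝ) *ᵥ v =
        (T v : Matrix (Fin n ⊕ Fin n) (Fin n ⊕ Fin n) ℝ) *ᵥ u :=
    fun u v => sub_eq_zero.1 (hT u v)
  have hl : ∀ u : Fin n → ℝ, T (Sum.elim u 0) = 0 := by
    intro u
    obtain ⟨a, ha⟩ := mem_deltaLie_iff.1 (T (Sum.elim u 0)).2
    refine Subtype.ext (ha.symm.trans ?_)
    have : a = 0 := by
      refine Matrix.ext_of_mulVec_single fun j => ?_
      generalize (Pi.single j 1 : Fin n → ℝ) = w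
      obtain ⟨b, hb⟩ := mem_deltaLie_iff.1 (T (Sum.elim 0 w)).2
      have h := hT' (Sum.elim u 0) (Sum.elim 0 w)
      rw [← ha, ← hb, fromBlocks_mulVec, fromBlocks_mulVec] at h
      simpa using congrArg (fun f => f ∘ Sum.inr) h
    simp [this]
  have hr : ∀ u : Fin n → ℝ, T (Sum.elim 0 u) = 0 := by
    intro u
    obtain ⟨a, ha⟩ := mem_deltaLie_iff.1 (T (Sum.elim 0 u)).2
    refine Subtype.ext (ha.symm.trans ?_)
    have : a = 0 := by
      refine Matrix.ext_of_mulVec_single fun j => ?_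
      generalize (Pi.single j 1 : Fin n → ℝ) = w
      have h := hT' (Sum.elim 0 u) (Sum.elim w 0)
      rw [← ha, hl, fromBlocks_mulVec] at h
      simpa using congrArg (fun f => f ∘ Sum.inl) h
    simp [this]
  rw [Submodule.mem_bot]
  refine LinearMap.ext fun u => ?_
  have hu : u = Sum.elim (fun i => u (.inl i)) 0 + 
      Sum.elim (0 : Fin n → ℝ) (fun i => u (.inr i)) := by
    ext (i | i) <;> simp
  rw [hu, map_add, hl, hr, add_zero, LinearMap.zero_apply]

end DeltaLie

/-! ### Solving for the connection form -/

section Alternation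

variable {ι : Type*}

/-- The torsion part `(k, j) ↦ W_k e_j - W_j e_k` of a connection form `W`, as the family of the
matrices of its contractions with the `k`-th basis vector. -/
def alternation (ι : Type*) : (ι → Matrix ι ι ℝ) →ₗ[ℝ] (ι → Matrix ι ι ℝ) where
  toFun W := fun k => Matrix.of fun i j => W k i j - W j i k
  map_add' W W' := by
    ext k i j
    simp only [Matrix.of_apply, Pi.add_apply, Matrix.add_apply]
    ring
  map_smul' c W := by
    ext k i j
    simp only [Matrix.of_apply, Pi.smul_apply, Matrix.smul_apply, smul_eq_mul, RingHom.id_apply]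
    ring

@[simp]
theorem alternation_apply (W : ι → Matrix ι ι ℝ) (k i j : ι) :
    alternation ι W k i j = W k i j - W j i k :=
  rfl

variable [Fintype ι]

/-- `alternation` is skew under exchanging `k` and `j`. Exchanging them in one of two copies of the
sum completes the square. -/
theorem two_mul_sum_trace_transpose_mul_alternation (W : ι → Matrix ι ι ℝ) :
    2 * ∑ k, ((W k)ᵀ * alternation ι W k).trace = ∑ k, ∑ j, ∑ i, alternation ι W k i j ^ 2 := by
  have h : ∑ k, ((W k)ᵀ * alternation ι W k).trace =
      ∑ k, ∑ j, ∑ i, W k i j * (W k i j - W j i k) := by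
    simp [Matrix.trace, Matrix.mul_apply]
  have h' : ∑ k, ∑ j, ∑ i, W k i j * (W k i j - W j i k) =
      ∑ k, ∑ j, ∑ i, W j i k * (W j i k - W k i j) :=
    Finset.sum_comm
  rw [two_mul, h]
  nth_rewrite 2 [h']
  simp only [← Finset.sum_add_distrib, alternation_apply]
  refine Finset.sum_congr rfl fun k _ => Finset.sum_congr rfl fun j _ =>
    Finset.sum_congr rfl fun i _ => ?_
  ring

variable [DecidableEq ι] {𝔤 : LieSubalgebra ℝ (Matrix ι ι ℝ)}

/-- Extended linearly in `k`, a `𝔤`-valued family with zero alternation is exactly an element of the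
first prolongation. -/
theorem eq_zero_of_alternation_eq_zero (h𝔤 : firstProlongation 𝔤 = ⊥) {W : ι → Matrix ι ι ℝ}
    (hW : ∀ k, W k ∈ 𝔤) (h : alternation ι W = 0) : W = 0 := by
  let T : (ι → ℝ) →ₗ[ℝ] 𝔤 := Fintype.linearCombination ℝ fun k => (⟨W k, hW k⟩ : 𝔤)
  have hsymm : ∀ k i j, W k i j = W j i k := fun k i j =>
    sub_eq_zero.1 (congrFun (congrFun (congrFun h k) i) j)
  have hTcoe : ∀ u, (T u : Matrix ι ι ℝ) = ∑ k, u k • W k := by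
    intro u
    have : T u = ∑ k, u k • (⟨W k, hW k⟩ : 𝔤) := Fintype.linearCombination_apply ..
    rw [this]
    exact map_sum 𝔤.toSubmodule.subtype _ _
  have hT : T ∈ firstProlongation 𝔤 := by
    intro u v
    rw [sub_eq_zero, hTcoe, hTcoe]
    ext i
    simp only [Matrix.mulVec, dotProduct, Matrix.sum_apply, Matrix.smul_apply, smul_eq_mul,
      Finset.sum_mul]
    rw [Finset.sum_comm]
    refine Finset.sum_congr rfl fun k _ => Finset.sum_congr rfl fun j _ => ?_
    rw [hsymm j i k]
    ring
  rw [h𝔤, Submodule.mem_bot] at hT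
  funext k
  have := hTcoe (Pi.single k 1)
  rw [hT] at this
  simpa [Pi.single_apply] using this.symm

/-- Testing against `A = (W k)ᵀ` turns the trace equations into a vanishing sum of squares. -/
theorem eq_zero_of_trace_mul_alternation_eq_zero (h𝔤 : firstProlongation 𝔤 = ⊥)
    (htr : ∀ A ∈ 𝔤, Aᵀ ∈ 𝔤) {W : ι → Matrix ι ι ℝ} (hW : ∀ k, W k ∈ 𝔤)
    (h : ∀ A ∈ 𝔤, ∀ k, (A * alternation ι W k).trace = 0) : W = 0 := by
  refine eq_zero_of_alternation_eq_zero h𝔤 hW ?_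
  have h2 := two_mul_sum_trace_transpose_mul_alternation W
  rw [Finset.sum_eq_zero fun k _ => h _ (htr _ (hW k)) k, mul_zero] at h2
  have h3 := (Finset.sum_eq_zero_iff_of_nonneg fun k _ => by positivity).1 h2.symm
  funext k
  have h4 := (Finset.sum_eq_zero_iff_of_nonneg fun j _ => by positivity).1 (h3 k (Finset.mem_univ _))
  ext i j
  have h5 := (Finset.sum_eq_zero_iff_of_nonneg fun i _ => by positivity).1 (h4 j (Finset.mem_univ _))
  exact pow_eq_zero_iff two_ne_zero |>.1 (h5 i (Finset.mem_univ _))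

/-- `L` is injective, and its source and target have the same dimension because `𝔤` and its dual do.
Linearity of `Λ` later makes the connection form depend smoothly on the structure functions. -/
theorem exists_linear_solution (h𝔤 : firstProlongation 𝔤 = ⊥) (htr : ∀ A ∈ 𝔤, Aᵀ ∈ 𝔤) :
    ∃ Λ : (ι → Matrix ι ι ℝ) →ₗ[ℝ] (ι → Matrix ι ι ℝ), ∀ c,
      (∀ k, Λ c k ∈ 𝔤) ∧ ∀ A ∈ 𝔤, ∀ k, (A * (alternation ι (Λ c) k - c k)).trace = 0 := by
  let pair : (ι → Matrix ι ι ℝ) →ₗ[ℝ] (ι → Module.Dual ℝ 𝔤.toSubmodule) :=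
    LinearMap.pi fun k =>
      LinearMap.mk₂ ℝ (fun (c : ι → Matrix ι ι ℝ) (A : 𝔤.toSubmodule) =>
          ((A : Matrix ι ι ℝ) * c k).trace)
        (by simp [mul_add]) (by simp) (by simp [add_mul]) (by simp)
  let incl : (ι → 𝔤.toSubmodule) →ₗ[ℝ] (ι → Matrix ι ι ℝ) :=
    LinearMap.pi fun k => 𝔤.toSubmodule.subtype ∘ₗ LinearMap.proj k
  have hpair : ∀ c k (A : 𝔤.toSubmodule), pair c k A = ((A : Matrix ι ι ℝ) * c k).trace :=
    fun _ _ _ => rfl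
  let L : (ι → 𝔤.toSubmodule) →ₗ[ℝ] (ι → Module.Dual ℝ 𝔤.toSubmodule) :=
    pair ∘ₗ alternation ι ∘ₗ incl
  have hL : Function.Injective L := by
    rw [← LinearMap.ker_eq_bot, LinearMap.ker_eq_bot']
    intro W hW
    have := eq_zero_of_trace_mul_alternation_eq_zero h𝔤 htr (W := incl W) (fun k => (W k).2)
      fun A hA k => DFunLike.congr_fun (congrFun hW k) ⟨A, hA⟩
    funext k
    exact Subtype.ext (congrFun this k)
  have hdim : Module.finrank ℝ (ι → 𝔤.toSubmodule) =
      Module.finrank ℝ (ι → Module.Dual ℝ 𝔤.toSubmodule) := by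
    simp [Module.finrank_pi_fintype, Subspace.dual_finrank_eq]
  let Le := LinearEquiv.ofInjectiveOfFinrankEq L hL hdim
  refine ⟨incl ∘ₗ Le.symm.toLinearMap ∘ₗ pair, fun c => ⟨fun k => (Le.symm (pair c) k).2, ?_⟩⟩
  intro A hA k
  have h1 : L (Le.symm (pair c)) = pair c := Le.apply_symm_apply (pair c)
  have h2 := DFunLike.congr_fun (congrFun h1 k) ⟨A, hA⟩
  rw [mul_sub, Matrix.trace_sub, sub_eq_zero]
  exact h2

end Alternation

/-! ### Smoothness in terms of local frames -/

section LocalFrames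

open Bundle Module Filter
open scoped Topology

variable {𝕜 : Type*} [NontriviallyNormedField 𝕜]
  {E : Type*} [NormedAddCommGroup E] [NormedSpace 𝕜 E]
  {H : Type*} [TopologicalSpace H] {I : ModelWithCorners 𝕜 E H}
  {M : Type*} [TopologicalSpace M] [ChartedSpace H M]
  {F : Type*} [NormedAddCommGroup F] [NormedSpace 𝕜 F]
  {V : M → Type*} [TopologicalSpace (TotalSpace F V)]
  [∀ x, AddCommGroup (V x)] [∀ x, Module 𝕜 (V x)]
  [∀ x : M, TopologicalSpace (V x)]
  [FiberBundle F V] [VectorBundle 𝕜 F V]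
  {ι : Type*} [Fintype ι] {k : ℕ∞ω} {x₀ : M} {e : ι → Π x : M, V x} {u : Set M}

/-- The linear map `a ↦ ∑ i, a_i e_i` attached to a family of sections `e`, read in the
trivialization at `x₀`. -/
def frameMap (𝕜 : Type*) [NontriviallyNormedField 𝕜] (F : Type*) [NormedAddCommGroup F]
    [NormedSpace 𝕜 F] {V : M → Type*} [TopologicalSpace (TotalSpace F V)]
    [∀ x : M, TopologicalSpace (V x)] [FiberBundle F V]
    (x₀ : M) (e : ι → Π x : M, V x) (x : M) : (ι → 𝕜) →L[𝕜] F :=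
  ∑ i, (ContinuousLinearMap.proj i : (ι → 𝕜) →L[𝕜] 𝕜).smulRight
    ((trivializationAt F V x₀) ⟨x, e i x⟩).2

theorem frameMap_apply {x : M} (hx : x ∈ (trivializationAt F V x₀).baseSet) (a : ι → 𝕜) :
    frameMap 𝕜 F x₀ e x a =
      (trivializationAt F V x₀).linearEquivAt 𝕜 x hx (∑ i, a i • e i x) := by
  simp [frameMap, map_sum]

theorem contMDiffAt_frameMap [ContMDiffVectorBundle k F V I]
    (he : ∀ i, CMDiffAt k (T% (e i)) x₀) :
    CMDiffAt k (frameMap 𝕜 F x₀ e) x₀ := by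
  have h : ∀ i, CMDiffAt k (fun x => ((trivializationAt F V x₀) ⟨x, e i x⟩).2) x₀ :=
    fun i => contMDiffAt_section _ |>.1 (he i)
  unfold frameMap
  refine ContMDiffAt.sum fun i _ => ?_
  exact (ContinuousLinearMap.smulRightL 𝕜 (ι → 𝕜) F
    (ContinuousLinearMap.proj i)).contMDiff.contMDiffAt.comp x₀ (h i)

variable [CompleteSpace 𝕜]

theorem isInvertible_frameMap {x : M} (hx : x ∈ (trivializationAt F V x₀).baseSet)
    (b : Basis ι 𝕜 (V x)) (hb : ∀ i, b i = e i x) : (frameMap 𝕜 F x₀ e x).IsInvertible := by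
  refine ⟨((b.equivFun.symm.trans
    ((trivializationAt F V x₀).linearEquivAt 𝕜 x hx))).toContinuousLinearEquiv, ?_⟩
  ext1 a
  simp [frameMap_apply hx, hb, Basis.equivFun_symm_apply]

/-- Coefficients in a frame are obtained by inverting its coordinate map. Smoothness of inversion
therefore yields smoothness of coefficients. -/
theorem inverse_frameMap_apply {x : M} (hx : x ∈ (trivializationAt F V x₀).baseSet)
    (b : Basis ι 𝕜 (V x)) (hb : ∀ i, b i = e i x) (v : V x) :
    (frameMap 𝕜 F x₀ e x).inverse ((trivializationAt F V x₀) ⟨x, v⟩).2 = b.equivFun v := by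
  have h : frameMap 𝕜 F x₀ e x (b.equivFun v) = ((trivializationAt F V x₀) ⟨x, v⟩).2 := by
    rw [frameMap_apply hx]
    simp only [← hb, Basis.sum_equivFun]
    rfl
  obtain ⟨A, hA⟩ := isInvertible_frameMap (𝕜 := 𝕜) hx b hb
  rw [← h, ← hA, ContinuousLinearMap.inverse_equiv]
  exact A.symm_apply_apply _

theorem contMDiffAt_inverse_frameMap [ContMDiffVectorBundle k F V I]
    (he : ∀ i, CMDiffAt k (T% (e i)) x₀) (b : Basis ι 𝕜 (V x₀)) (hb : ∀ i, b i = e i x₀) :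
    CMDiffAt k (fun x => (frameMap 𝕜 F x₀ e x).inverse) x₀ := by
  have h := (isInvertible_frameMap (𝕜 := 𝕜) (F := F)
    (FiberBundle.mem_baseSet_trivializationAt' x₀) b hb).contDiffAt_map_inverse (n := k)
  exact h.contMDiffAt.comp x₀ (contMDiffAt_frameMap he)

namespace IsLocalFrameOn

theorem coeff_eventuallyEq (hs : IsLocalFrameOn I F k e u) (hu : u ∈ 𝓝 x₀) (σ : Π x : M, V x)
    (i : ι) : (fun x => hs.coeff i x (σ x)) =ᶠ[𝓝 x₀]
      fun x => (frameMap 𝕜 F x₀ e x).inverse ((trivializationAt F V x₀) ⟨x, σ x⟩).2 i := by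
  filter_upwards [hu, (trivializationAt F V x₀).open_baseSet.mem_nhds
    (FiberBundle.mem_baseSet_trivializationAt' x₀)] with x hx hx'
  rw [inverse_frameMap_apply hx' (hs.toBasisAt hx) (hs.toBasisAt_coe hx), hs.coeff_apply_of_mem hx]
  rfl

/-- The coefficients of a `C^k` section in a `C^k` local frame are `C^k`. -/
theorem contMDiffAt_coeff [ContMDiffVectorBundle k F V I] (hs : IsLocalFrameOn I F k e u)
    (hu : u ∈ 𝓝 x₀) {σ : Π x : M, V x} (hσ : CMDiffAt k (T% σ) x₀) (i : ι) :
    CMDiffAt k (fun x => hs.coeff i x (σ x)) x₀ := by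
  refine ContMDiffAt.congr_of_eventuallyEq ?_ (hs.coeff_eventuallyEq hu σ i)
  have hx₀ := mem_of_mem_nhds hu
  have h1 := contMDiffAt_inverse_frameMap (fun i => (hs.contMDiffOn i).contMDiffAt hu)
    (hs.toBasisAt hx₀) (hs.toBasisAt_coe hx₀)
  have h2 := h1.clm_apply (contMDiffAt_section _ |>.1 hσ)
  exact (ContinuousLinearMap.proj (R := 𝕜) (φ := fun _ : ι => 𝕜) i).contMDiff.contMDiffAt.comp x₀ h2

/-- The coefficients of a differentiable section in a `C^k` local frame are differentiable. -/
theorem mdifferentiableAt_coeff [ContMDiffVectorBundle k F V I] (hk : k ≠ 0)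
    (hs : IsLocalFrameOn I F k e u)
    (hu : u ∈ 𝓝 x₀) {σ : Π x : M, V x} (hσ : MDiffAt (T% σ) x₀) (i : ι) :
    MDiffAt (fun x => hs.coeff i x (σ x)) x₀ := by
  refine MDifferentiableAt.congr_of_eventuallyEq ?_ (hs.coeff_eventuallyEq hu σ i)
  have hx₀ := mem_of_mem_nhds hu
  have h1 := (contMDiffAt_inverse_frameMap (fun i => (hs.contMDiffOn i).contMDiffAt hu)
    (hs.toBasisAt hx₀) (hs.toBasisAt_coe hx₀)).mdifferentiableAt hk
  have h2 := h1.clm_apply (mdifferentiableAt_section I _ |>.1 hσ)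
  exact (ContinuousLinearMap.proj (R := 𝕜) (φ := fun _ : ι => 𝕜) i).contMDiff.contMDiffAt
    |>.mdifferentiableAt one_ne_zero |>.comp x₀ h2

/-- A section of a bundle of homomorphisms is `C^k` if the images of the vectors of a `C^k` local
frame are `C^k`. -/
theorem contMDiffAt_hom {F₂ : Type*} [NormedAddCommGroup F₂] [NormedSpace 𝕜 F₂]
    {V₂ : M → Type*} [TopologicalSpace (TotalSpace F₂ V₂)]
    [∀ x, AddCommGroup (V₂ x)] [∀ x, Module 𝕜 (V₂ x)] [∀ x : M, TopologicalSpace (V₂ x)]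
    [∀ x, IsTopologicalAddGroup (V₂ x)] [∀ x, ContinuousSMul 𝕜 (V₂ x)]
    [FiberBundle F₂ V₂] [VectorBundle 𝕜 F₂ V₂]
    [ContMDiffVectorBundle k F V I] [ContMDiffVectorBundle k F₂ V₂ I]
    (hs : IsLocalFrameOn I F k e u) (hu : u ∈ 𝓝 x₀) {S : Π x : M, V x →L[𝕜] V₂ x}
    (hS : ∀ i, CMDiffAt k (T% fun x => S x (e i x)) x₀) :
    ContMDiffAt I (I.prod 𝓘(𝕜, F →L[𝕜] F₂)) k
      (fun x => TotalSpace.mk' (F →L[𝕜] F₂) (E := fun x => V x →L[𝕜] V₂ x) x (S x)) x₀ := by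
  rw [contMDiffAt_hom_bundle]
  refine ⟨contMDiffAt_id, ?_⟩
  have hx₀ := mem_of_mem_nhds hu
  have h1 := contMDiffAt_inverse_frameMap (fun i => (hs.contMDiffOn i).contMDiffAt hu)
    (hs.toBasisAt hx₀) (hs.toBasisAt_coe hx₀)
  have h2 : CMDiffAt k (frameMap 𝕜 F₂ x₀ fun i x => S x (e i x)) x₀ := contMDiffAt_frameMap hS
  -- In coordinates, `S` is the map `a ↦ ∑ a_i S e_i` composed with the inverse of `a ↦ ∑ a_i e_i`.
  refine (h2.clm_comp h1).congr_of_eventuallyEq ?_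
  filter_upwards [hu, (trivializationAt F V x₀).open_baseSet.mem_nhds
    (FiberBundle.mem_baseSet_trivializationAt' x₀),
    (trivializationAt F₂ V₂ x₀).open_baseSet.mem_nhds
    (FiberBundle.mem_baseSet_trivializationAt' x₀)] with x hx hx1 hx2
  ext1 w
  obtain ⟨v, rfl⟩ := ((trivializationAt F V x₀).continuousLinearEquivAt 𝕜 x hx1).surjective w
  have h3 : (frameMap 𝕜 F x₀ e x).inverse
      ((trivializationAt F V x₀).continuousLinearEquivAt 𝕜 x hx1 v) = (hs.toBasisAt hx).equivFun v :=
    inverse_frameMap_apply hx1 (hs.toBasisAt hx) (hs.toBasisAt_coe hx) v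
  have h4 : ∑ i, (hs.toBasisAt hx).equivFun v i • S x (e i x) = S x v := by
    conv_rhs => rw [← (hs.toBasisAt hx).sum_equivFun v]
    simp [map_sum]
  rw [ContinuousLinearMap.inCoordinates_eq hx1 hx2, ContinuousLinearMap.comp_apply,
    ContinuousLinearMap.comp_apply, ContinuousLinearMap.comp_apply, h3, frameMap_apply hx2, h4]
  exact congrArg (fun v => (trivializationAt F₂ V₂ x₀).continuousLinearEquivAt 𝕜 x hx2 (S x v))
    (((trivializationAt F V x₀).continuousLinearEquivAt 𝕜 x hx1).symm_apply_apply v)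

end IsLocalFrameOn

/-- Sections which form a basis at one point form a local frame near this point. -/
theorem exists_isLocalFrameOn [FiniteDimensional 𝕜 F] [ContMDiffVectorBundle k F V I] (hu : IsOpen u) (hx₀ : x₀ ∈ u)
    (he : ∀ i, CMDiff[u] k (T% (e i))) (b : Basis ι 𝕜 (V x₀)) (hb : ∀ i, b i = e i x₀) :
    ∃ w ⊆ u, IsOpen w ∧ x₀ ∈ w ∧ IsLocalFrameOn I F k e w := by
  have hcont : ContinuousAt (frameMap 𝕜 F x₀ e) x₀ :=
    (contMDiffAt_frameMap fun i => (he i).contMDiffAt (hu.mem_nhds hx₀)).continuousAt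
  have hF : CompleteSpace F := FiniteDimensional.complete 𝕜 F
  have hinv := isInvertible_frameMap (𝕜 := 𝕜) (F := F)
    (FiberBundle.mem_baseSet_trivializationAt' x₀) b hb
  -- Being a basis is an open condition, since invertible maps form an open set.
  have hopen : IsOpen (Set.range ((↑) : ((ι → 𝕜) ≃L[𝕜] F) → (ι → 𝕜) →L[𝕜] F)) :=
    ContinuousLinearEquiv.isOpen
  have hev := hcont.preimage_mem_nhds (hopen.mem_nhds hinv)
  obtain ⟨w, hw, hwo, hxw⟩ := mem_nhds_iff.1 (inter_mem hev (inter_mem (hu.mem_nhds hx₀)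
    ((trivializationAt F V x₀).open_baseSet.mem_nhds
      (FiberBundle.mem_baseSet_trivializationAt' x₀))))
  have hbasis : ∀ x ∈ w, ∃ b : Basis ι 𝕜 (V x), ∀ i, b i = e i x := by
    intro x hx
    obtain ⟨⟨A, hA⟩, -, hxb⟩ := hw hx
    refine ⟨(Pi.basisFun 𝕜 ι).map (A.toLinearEquiv.trans
      ((trivializationAt F V x₀).linearEquivAt 𝕜 x hxb).symm), fun i => ?_⟩
    rw [Basis.map_apply, LinearEquiv.trans_apply, LinearEquiv.symm_apply_eq]
    have : A (Pi.basisFun 𝕜 ι i) = frameMap 𝕜 F x₀ e x (Pi.basisFun 𝕜 ι i) := by rw [← hA]; rfl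
    refine this.trans ?_
    classical
    rw [frameMap_apply hxb]
    simp [Pi.single_apply]
  refine ⟨w, fun x hx => (hw hx).2.1, hwo, hxw, ?_, ?_, fun i => (he i).mono fun x hx => (hw hx).2.1⟩
  · intro x hx
    obtain ⟨b, hb⟩ := hbasis x hx
    rw [← funext hb]
    exact b.linearIndependent
  · intro x hx
    obtain ⟨b, hb⟩ := hbasis x hx
    rw [← funext hb]
    exact b.span_eq.ge

end LocalFrames

theorem trace_comp_eq_trace_toMatrix_mul {V : Type*} [AddCommGroup V] [Module ℝ V]
    [TopologicalSpace V] {ι : Type*} [Fintype ι] [DecidableEq ι] (b : Module.Basis ι ℝ V)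
    (S T : V →L[ℝ] V) :
    LinearMap.trace ℝ V ((S ∘L T : V →L[ℝ] V) : V →ₗ[ℝ] V) =
      (LinearMap.toMatrix b b (S : V →ₗ[ℝ] V) * LinearMap.toMatrix b b (T : V →ₗ[ℝ] V)).trace := by
  rw [← LinearMap.toMatrix_comp, LinearMap.trace_eq_matrix_trace ℝ b]
  rfl

/-! ### Connections, connection forms and torsion in a local frame. -/

section Connections

open Bundle Module Filter VectorField
open scoped Topology

variable {E : Type*} [NormedAddCommGroup E] [NormedSpace ℝ E]
  {M : Type*} [TopologicalSpace M] [ChartedSpace E M] [IsManifold 𝓘(ℝ, E) ∞ M]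
  {ι : Type*} [Fintype ι] {B B' : FrameFamily E M ι} {U : Set M} {x : M}
  {e : ι → Π x : M, TangentSpace 𝓘(ℝ, E) x}

omit [Fintype ι] in
theorem IsLocalSection.isLocalFrameOn (h : IsLocalSection B U e) :
    IsLocalFrameOn 𝓘(ℝ, E) E ∞ e U where
  contMDiffOn := h.1
  linearIndependent := by
    intro x hx
    obtain ⟨b, -, hb⟩ := h.2 x hx
    rw [← funext hb]
    exact b.linearIndependent
  generating := by
    intro x hx
    obtain ⟨b, -, hb⟩ := h.2 x hx
    rw [← funext hb]
    exact b.span_eq.ge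

omit [Fintype ι] in
theorem IsLocalFrameOn.mdifferentiableAt (hs : IsLocalFrameOn 𝓘(ℝ, E) E ∞ e U)
    (hU : U ∈ 𝓝 x) (i : ι) : MDiffAt (T% (e i)) x :=
  ((hs.contMDiffOn i).contMDiffAt hU).mdifferentiableAt (by simp)

/-! ### Derivatives of functions with values in a subspace -/

omit [IsManifold 𝓘(ℝ, E) ∞ M] in
theorem Filter.EventuallyEq.mvfderiv_eq {f g : M → ℝ} (h : f =ᶠ[𝓝 x] g) : d% f x = d% g x := by
  rw [mvfderiv, mvfderiv, h.mfderiv_eq]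
  rfl

omit [IsManifold 𝓘(ℝ, E) ∞ M] in
theorem mvfderiv_sum_mul_const {κ : Type*} {s : Finset κ} (c : κ → ℝ) {f : κ → M → ℝ}
    (hf : ∀ k ∈ s, MDiffAt (f k) x) (v : TangentSpace 𝓘(ℝ, E) x) :
    MDiffAt (fun y => ∑ k ∈ s, f k y * c k) x ∧
    d% (fun y => ∑ k ∈ s, f k y * c k) x v = ∑ k ∈ s, d% (f k) x v * c k := by
  classical
  induction s using Finset.induction_on with
  | empty => simpa using! ⟨mdifferentiableAt_const, DFunLike.congr_fun (mvfderiv_const (0 : ℝ)) v⟩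
  | insert a s ha ih =>
    obtain ⟨ih1, ih2⟩ := ih fun k hk => hf k (Finset.mem_insert_of_mem hk)
    have ha1 := hf a (Finset.mem_insert_self _ _)
    have hc : MDiffAt (fun _ : M => c a) x := mdifferentiableAt_const
    have hac : MDiffAt (fun y => f a y * c a) x := ha1.mul hc
    simp only [Finset.sum_insert ha]
    refine ⟨hac.add ih1, ?_⟩
    rw [mvfderiv_fun_add hac ih1, mvfderiv_fun_mul ha1 hc, mvfderiv_const,
      add_apply, ih2]
    simp [mul_comm]

omit [IsManifold 𝓘(ℝ, E) ∞ M] in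
/-- The derivative of a function with values in a subspace, given by its coordinates in a basis,
belongs to the subspace. -/
theorem sum_mvfderiv_smul_mem {κ V : Type*} [Fintype κ] [AddCommGroup V] [Module ℝ V]
    (β : Basis κ ℝ V) (p : Submodule ℝ V) {f : κ → M → ℝ} (hf : ∀ k, MDiffAt (f k) x)
    (hp : ∀ᶠ y in 𝓝 x, ∑ k, f k y • β k ∈ p) (v : TangentSpace 𝓘(ℝ, E) x) :
    ∑ k, d% (f k) x v • β k ∈ p := by
  by_contra h
  -- A functional vanishing on `p` but not on the derivative gives a contradiction: its composite
  -- with the function is locally zero.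
  obtain ⟨φ, hφ, hpφ⟩ := Submodule.exists_le_ker_of_notMem h
  refine hφ ?_
  rw [map_sum]
  simp only [map_smul, smul_eq_mul]
  rw [← (mvfderiv_sum_mul_const (fun k => φ (β k)) (fun k _ => hf k) v).2]
  have : (fun y => ∑ k, f k y * φ (β k)) =ᶠ[𝓝 x] fun _ => 0 := by
    filter_upwards [hp] with y hy
    simpa using hpφ hy
  rw [this.mvfderiv_eq, mvfderiv_const]
  rfl

/-! ### A connection is determined by its values on a frame -/

omit [Fintype ι] in
theorem LinearConnection.apply_sum (cov : LinearConnection E M) {s : Finset ι}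
    {σ : ι → Π x : M, TangentSpace 𝓘(ℝ, E) x} (hσ : ∀ i ∈ s, MDiffAt (T% (σ i)) x) :
    cov (∑ i ∈ s, σ i) x = ∑ i ∈ s, cov (σ i) x := by
  classical
  induction s using Finset.induction_on with
  | empty => simp
  | insert a s ha ih =>
    rw [Finset.sum_insert ha, Finset.sum_insert ha,
      cov.isCovariantDerivativeOnUniv.add (hσ a (Finset.mem_insert_self _ _)),
      ih fun i hi => hσ i (Finset.mem_insert_of_mem hi)]
    have := MDifferentiableAt.sum_section (I := 𝓘(ℝ, E)) (x₀ := x) (s := s) (t := σ)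
      fun i hi => hσ i (Finset.mem_insert_of_mem hi)
    convert! this using 3
    simp

theorem LinearConnection.apply_eq_sum_coeff (cov : LinearConnection E M)
    (hs : IsLocalFrameOn 𝓘(ℝ, E) E ∞ e U) (hU : U ∈ 𝓝 x)
    {σ : Π x : M, TangentSpace 𝓘(ℝ, E) x} (hσ : MDiffAt (T% σ) x) :
    cov σ x = ∑ i, (hs.coeff i x (σ x) • cov (e i) x +
      (d% (fun y => hs.coeff i y (σ y)) x).smulRight (e i x)) := by
  have hc : ∀ i, MDiffAt (fun y => hs.coeff i y (σ y)) x :=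
    fun i => hs.mdifferentiableAt_coeff (by simp) hU hσ i
  have hce : ∀ i, MDiffAt (T% ((fun y => hs.coeff i y (σ y)) • e i)) x :=
    fun i => (hc i).smul_section (hs.mdifferentiableAt hU i)
  have hsum : MDiffAt (T% (∑ i, (fun y => hs.coeff i y (σ y)) • e i)) x := by
    have := MDifferentiableAt.sum_section (I := 𝓘(ℝ, E)) (x₀ := x) (s := Finset.univ)
      fun i _ => hce i
    convert! this using 3
    simp
  rw [cov.isCovariantDerivativeOnUniv.congr_of_eventuallyEq hσ hsum Filter.univ_mem,
    cov.apply_sum fun i _ => hce i]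
  · exact Finset.sum_congr rfl fun i _ =>
      cov.isCovariantDerivativeOnUniv.leibniz (hs.mdifferentiableAt hU i) (hc i)
  · filter_upwards [hs.eventually_eq_sum_coeff_smul σ hU] with y hy
    simpa using hy

theorem connectionEqAt_of_frame {cov cov' : LinearConnection E M}
    (hs : IsLocalFrameOn 𝓘(ℝ, E) E ∞ e U) (hU : U ∈ 𝓝 x)
    (h : ∀ i, cov (e i) x = cov' (e i) x) : ConnectionEqAt cov cov' x := by
  intro Y hY
  rw [cov.apply_eq_sum_coeff hs hU hY, cov'.apply_eq_sum_coeff hs hU hY]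
  simp only [h]

/-! ### Connection forms and torsion in a frame -/

/-- The matrices of the contractions of the bracket of a frame with the vectors of the frame:
`[e_k, e_j] = ∑ i, (C_k)_ij e_i`. -/
def structureMatrix (hs : IsLocalFrameOn 𝓘(ℝ, E) E ∞ e U) (x : M) : ι → Matrix ι ι ℝ :=
  fun k => Matrix.of fun i j => hs.coeff i x (mlieBracket 𝓘(ℝ, E) (e k) (e j) x)

variable [FiniteDimensional ℝ E] [CompleteSpace E] [DecidableEq ι]

/-- This is `T(e_k, e_j) = ∇_{e_k} e_j - ∇_{e_j} e_k - [e_k, e_j]` in coordinates: the torsion is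
affine in the connection form, with a constant term that depends only on the frame. -/
theorem toMatrix_torsion (cov : LinearConnection E M) (hs : IsLocalFrameOn 𝓘(ℝ, E) E ∞ e U)
    (hU : U ∈ 𝓝 x) {b : Basis ι ℝ (TangentSpace 𝓘(ℝ, E) x)} (hb : ∀ i, b i = e i x)
    {W : ι → Matrix ι ι ℝ} (hW : ∀ k j, cov (e j) x (e k x) = ∑ i, W k i j • e i x) (k : ι) :
    LinearMap.toMatrix b b (cov.torsion x (b k) : TangentSpace 𝓘(ℝ, E) x →ₗ[ℝ] _) =
      alternation ι W k - structureMatrix hs x k := by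
  ext i j
  have hx := mem_of_mem_nhds hU
  have hbe : hs.toBasisAt hx = b := by
    ext1 i
    rw [hs.toBasisAt_coe, hb]
  rw [LinearMap.toMatrix_apply, ContinuousLinearMap.coe_coe, hb k, hb j,
    cov.torsion_apply (hs.mdifferentiableAt hU k) (hs.mdifferentiableAt hU j), hW, hW]
  simp only [← hb, map_sub, map_sum, map_smul, Finsupp.sub_apply]
  rw [Finsupp.finsetSum_apply, Finsupp.finsetSum_apply]
  simp [structureMatrix, hbe, Finsupp.single_apply, hx]

end Connections

section WellAdapted

open Bundle Module Filter VectorField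
open scoped Topology

variable {E : Type*} [NormedAddCommGroup E] [NormedSpace ℝ E] [FiniteDimensional ℝ E]
  [CompleteSpace E]
  {M : Type*} [TopologicalSpace M] [ChartedSpace E M] [IsManifold 𝓘(ℝ, E) ∞ M]
  {ι : Type*} [Fintype ι] [DecidableEq ι] {B B' : FrameFamily E M ι} {U : Set M} {x : M}
  {e : ι → Π x : M, TangentSpace 𝓘(ℝ, E) x} {𝔤 : LieSubalgebra ℝ (Matrix ι ι ℝ)}

/-! ### Uniqueness -/

/-- Two connections whose forms in a frame take values in `𝔤` at `x` and whose torsions satisfy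
the trace condition at `x` agree on this frame at `x`. -/
theorem apply_frame_eq_of_trace_eq_zero (h𝔤 : firstProlongation 𝔤 = ⊥)
    (htr : ∀ A ∈ 𝔤, Aᵀ ∈ 𝔤) {cov cov' : LinearConnection E M}
    (hs : IsLocalFrameOn 𝓘(ℝ, E) E ∞ e U) (hU : U ∈ 𝓝 x)
    {b : Basis ι ℝ (TangentSpace 𝓘(ℝ, E) x)} (hb : ∀ i, b i = e i x)
    (hW : ∀ v, ∃ W ∈ 𝔤, ∀ j, cov (e j) x v = ∑ i, W i j • e i x)
    (hW' : ∀ v, ∃ W ∈ 𝔤, ∀ j, cov' (e j) x v = ∑ i, W i j • e i x)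
    (hT : ∀ A ∈ 𝔤, ∀ k, (A * LinearMap.toMatrix b b
      (cov.torsion x (b k) : TangentSpace 𝓘(ℝ, E) x →ₗ[ℝ] _)).trace = 0)
    (hT' : ∀ A ∈ 𝔤, ∀ k, (A * LinearMap.toMatrix b b
      (cov'.torsion x (b k) : TangentSpace 𝓘(ℝ, E) x →ₗ[ℝ] _)).trace = 0) (j : ι) :
    cov (e j) x = cov' (e j) x := by
  choose W hWg hWe using fun k => hW (e k x)
  choose W' hWg' hWe' using fun k => hW' (e k x)
  -- The structure functions cancel in the difference, which solves the homogeneous system.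
  have hzero : W - W' = 0 := by
    refine eq_zero_of_trace_mul_alternation_eq_zero h𝔤 htr
      (fun k => 𝔤.sub_mem (hWg k) (hWg' k)) fun A hA k => ?_
    have h1 := hT A hA k
    have h2 := hT' A hA k
    rw [toMatrix_torsion cov hs hU hb hWe] at h1
    rw [toMatrix_torsion cov' hs hU hb hWe'] at h2
    have h3 : alternation ι (W - W') k = (alternation ι W k - structureMatrix hs x k) -
        (alternation ι W' k - structureMatrix hs x k) := by
      rw [map_sub, Pi.sub_apply]
      abel
    rw [h3, mul_sub, Matrix.trace_sub, h1, h2, sub_zero]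
  rw [sub_eq_zero] at hzero
  refine ContinuousLinearMap.coe_injective (b.ext fun k => ?_)
  simp only [hb, ContinuousLinearMap.coe_coe]
  rw [hWe, hWe', hzero]

/-! ### Construction in a frame -/

omit [FiniteDimensional ℝ E] [CompleteSpace E] [IsManifold 𝓘(ℝ, E) ∞ M] in
instance (x : M) : T2Space (TangentSpace 𝓘(ℝ, E) x) := inferInstanceAs (T2Space E)

omit [CompleteSpace E] [IsManifold 𝓘(ℝ, E) ∞ M] in
instance (x : M) : FiniteDimensional ℝ (TangentSpace 𝓘(ℝ, E) x) :=
  inferInstanceAs (FiniteDimensional ℝ E)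

/-- The connection form of the solution `Λ` of the trace condition in a frame. -/
def frameForm (Λ : (ι → Matrix ι ι ℝ) →ₗ[ℝ] (ι → Matrix ι ι ℝ))
    (hs : IsLocalFrameOn 𝓘(ℝ, E) E ∞ e U) (x : M) (v : TangentSpace 𝓘(ℝ, E) x) : Matrix ι ι ℝ :=
  ∑ k, hs.coeff k x v • Λ (structureMatrix hs x) k

/-- The covariant derivative with connection form `frameForm` in a frame. -/
def frameCov (Λ : (ι → Matrix ι ι ℝ) →ₗ[ℝ] (ι → Matrix ι ι ℝ))
    (hs : IsLocalFrameOn 𝓘(ℝ, E) E ∞ e U) (σ : Π x : M, TangentSpace 𝓘(ℝ, E) x) (x : M) :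
    TangentSpace 𝓘(ℝ, E) x →L[ℝ] TangentSpace 𝓘(ℝ, E) x :=
  ∑ j, ((d% (fun y => hs.coeff j y (σ y)) x).smulRight (e j x) +
    hs.coeff j x (σ x) • ∑ k, (LinearMap.toContinuousLinearMap (hs.coeff k x)).smulRight
      (∑ i, Λ (structureMatrix hs x) k i j • e i x))

variable {Λ : (ι → Matrix ι ι ℝ) →ₗ[ℝ] (ι → Matrix ι ι ℝ)}

omit [CompleteSpace E] [DecidableEq ι] in
theorem isCovariantDerivativeOn_frameCov (hs : IsLocalFrameOn 𝓘(ℝ, E) E ∞ e U) (hU : IsOpen U) :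
    IsCovariantDerivativeOn E (frameCov Λ hs) U where
  add {σ σ' x} hσ hσ' hx := by
    have h := fun i => hs.mdifferentiableAt_coeff (by simp) (hU.mem_nhds hx) hσ i
    have h' := fun i => hs.mdifferentiableAt_coeff (by simp) (hU.mem_nhds hx) hσ' i
    unfold frameCov
    rw [← Finset.sum_add_distrib]
    refine Finset.sum_congr rfl fun j _ => ?_
    have : d% (fun y => hs.coeff j y ((σ + σ') y)) x =
        d% (fun y => hs.coeff j y (σ y)) x + d% (fun y => hs.coeff j y (σ' y)) x := by
      rw [← mvfderiv_add (h j) (h' j)]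
      congr 1
      ext y
      simp
    rw [this, Pi.add_apply, map_add]
    ext1 v
    simp
    module
  leibniz {σ g x} hσ hg hx := by
    have h := fun i => hs.mdifferentiableAt_coeff (by simp) (hU.mem_nhds hx) hσ i
    have hsum := hs.coeff_sum_eq σ hx
    have : ∀ j, d% (fun y => hs.coeff j y ((g • σ) y)) x =
        g x • d% (fun y => hs.coeff j y (σ y)) x + hs.coeff j x (σ x) • d% g x := by
      intro j
      rw [← mvfderiv_mul hg (h j)]
      congr 1
      ext y
      simp
    have hsmul : (d% g x).smulRight (σ x) =
        ∑ j, (hs.coeff j x (σ x) • d% g x).smulRight (e j x) := by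
      ext1 v
      conv_lhs => rw [hsum]
      simp [Finset.smul_sum, smul_smul, mul_comm]
    unfold frameCov
    rw [hsmul, Finset.smul_sum, ← Finset.sum_add_distrib]
    refine Finset.sum_congr rfl fun j _ => ?_
    rw [this, Pi.smul_apply', map_smul]
    ext1 v
    simp
    module

omit [CompleteSpace E] in
theorem frameCov_apply_frame (hs : IsLocalFrameOn 𝓘(ℝ, E) E ∞ e U) (hU : U ∈ 𝓝 x) (j : ι)
    (v : TangentSpace 𝓘(ℝ, E) x) :
    frameCov Λ hs (e j) x v = ∑ i, frameForm Λ hs x v i j • e i x := by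
  have hx := mem_of_mem_nhds hU
  have hcoeff : ∀ i, ∀ y ∈ U, hs.coeff i y (e j y) = if i = j then 1 else 0 := by
    intro i y hy
    rw [hs.coeff_apply_of_mem hy, ← hs.toBasisAt_coe hy, Basis.repr_self, Finsupp.single_apply]
    simp only [eq_comm]
  have hd : ∀ i, d% (fun y => hs.coeff i y (e j y)) x = 0 := by
    intro i
    have : (fun y => hs.coeff i y (e j y)) =ᶠ[𝓝 x] fun _ => if i = j then 1 else 0 := by
      filter_upwards [hU] with y hy using hcoeff i y hy
    rw [this.mvfderiv_eq, mvfderiv_const]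
  simp only [frameCov, hd, hcoeff _ x hx]
  simp [frameForm, Finset.sum_smul, Matrix.sum_apply, Finset.smul_sum, smul_smul]
  exact Finset.sum_comm

end WellAdapted

section WellAdapted

open Bundle Module Filter VectorField
open scoped Topology

variable {E : Type*} [NormedAddCommGroup E] [NormedSpace ℝ E] [FiniteDimensional ℝ E]
  [CompleteSpace E]
  {M : Type*} [TopologicalSpace M] [ChartedSpace E M] [IsManifold 𝓘(ℝ, E) ∞ M]
  {ι : Type*} [Fintype ι] [DecidableEq ι] {B B' : FrameFamily E M ι} {U U' : Set M} {x : M}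
  {e e' : ι → Π x : M, TangentSpace 𝓘(ℝ, E) x} {𝔤 : LieSubalgebra ℝ (Matrix ι ι ℝ)}

/-! ### Independence of the frame -/

omit [FiniteDimensional ℝ E] [CompleteSpace E] in
/-- If the connection form of `cov` at `x` takes values in `𝔤` in one local frame of `B`, then it
does so in every local frame of `B`. -/
theorem exists_apply_frame_eq (hmul : ∀ A ∈ 𝔤, ∀ A' ∈ 𝔤, A * A' ∈ 𝔤)
    (hB : ∀ x, ∀ b ∈ B x, ∀ b' ∈ B x, b.toMatrix b' ∈ 𝔤) {cov : LinearConnection E M}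
    (hU : U ∈ 𝓝 x) (he : IsLocalSection B U e) (hU' : U' ∈ 𝓝 x) (he' : IsLocalSection B U' e')
    (hW : ∀ v, ∃ W ∈ 𝔤, ∀ j, cov (e j) x v = ∑ i, W i j • e i x)
    (v : TangentSpace 𝓘(ℝ, E) x) :
    ∃ W ∈ 𝔤, ∀ j, cov (e' j) x v = ∑ i, W i j • e' i x := by
  have hs := he.isLocalFrameOn
  have hs' := he'.isLocalFrameOn
  obtain ⟨W, hWg, hW⟩ := hW v
  let g : M → Matrix ι ι ℝ := fun y => Matrix.of fun i j => hs.coeff i y (e' j y)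
  have hg : ∀ y ∈ U, y ∈ U' → g y ∈ 𝔤 := by
    intro y hy hy'
    obtain ⟨b, hb, hbe⟩ := he.2 y hy
    obtain ⟨b', hb', hbe'⟩ := he'.2 y hy'
    have : g y = b.toMatrix b' := by
      ext i j
      have hbb : hs.toBasisAt hy = b := by
        ext1 i
        rw [hs.toBasisAt_coe, hbe]
      simp only [g, Matrix.of_apply, Basis.toMatrix_apply]
      rw [hs.coeff_apply_of_mem hy, hbb, hbe']
    rw [this]
    exact hB y b hb b' hb'
  let D : Matrix ι ι ℝ := Matrix.of fun i j => d% (fun y => hs.coeff i y (e' j y)) x v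
  have hsum : ∀ A : Matrix ι ι ℝ, ∑ k : ι × ι, A k.1 k.2 • Matrix.stdBasis ℝ ι ι k = A := by
    intro A
    conv_rhs => rw [← (Matrix.stdBasis ℝ ι ι).sum_repr A]
    rfl
  -- The transition matrix `g` takes values in the linear space `𝔤` near `x`, hence so does its
  -- derivative.
  have hD : D ∈ 𝔤 := by
    have := sum_mvfderiv_smul_mem (Matrix.stdBasis ℝ ι ι) 𝔤.toSubmodule
      (f := fun k y => g y k.1 k.2)
      (fun k => hs.mdifferentiableAt_coeff (by simp) hU (hs'.mdifferentiableAt hU' k.2) k.1)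
      (by
        filter_upwards [hU, hU'] with y hy hy'
        rw [hsum]
        exact hg y hy hy') v
    change ∑ k : ι × ι, D k.1 k.2 • _ ∈ 𝔤.toSubmodule at this
    rwa [hsum D] at this
  obtain ⟨b, hb, hbe⟩ := he.2 x (mem_of_mem_nhds hU)
  obtain ⟨b', hb', hbe'⟩ := he'.2 x (mem_of_mem_nhds hU')
  -- The gauge transformation `W' = g⁻¹ (W g + dg)`, with `g⁻¹ = b'.toMatrix b`. All factors lie in
  -- `𝔤`, which is closed under products.
  refine ⟨b'.toMatrix b * (W * g x + D), hmul _ (hB x b' hb' b hb) _ (𝔤.add_mem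
    (hmul _ hWg _ (hg x (mem_of_mem_nhds hU) (mem_of_mem_nhds hU'))) hD), fun j => ?_⟩
  have h1 : cov (e' j) x v = ∑ i, (W * g x + D) i j • e i x := by
    rw [cov.apply_eq_sum_coeff hs hU (hs'.mdifferentiableAt hU' j)]
    simp only [sum_apply, add_apply,
      smul_apply, hW, ContinuousLinearMap.smulRight_apply, Matrix.add_apply,
      add_smul, Finset.sum_add_distrib, Matrix.mul_apply, Finset.sum_smul, Finset.smul_sum]
    congr 1
    rw [Finset.sum_comm]
    refine Finset.sum_congr rfl fun i _ => Finset.sum_congr rfl fun l _ => ?_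
    rw [smul_smul, mul_comm]
    rfl
  have h2 : ∀ l, e l x = ∑ m, b'.toMatrix b m l • e' m x := by
    intro l
    have := b'.sum_toMatrix_smul_self b l
    rw [hbe] at this
    simp only [hbe'] at this
    exact this.symm
  rw [h1]
  simp only [h2, Matrix.mul_apply (M := b'.toMatrix b), Finset.sum_smul, Finset.smul_sum]
  rw [Finset.sum_comm]
  refine Finset.sum_congr rfl fun i _ => Finset.sum_congr rfl fun l _ => ?_
  rw [smul_smul, mul_comm]

omit [FiniteDimensional ℝ E] [CompleteSpace E] [IsManifold 𝓘(ℝ, E) ∞ M] in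
theorem toMatrix_mem_of_mem_adjointFibre (hmul : ∀ A ∈ 𝔤, ∀ A' ∈ 𝔤, A * A' ∈ 𝔤)
    (hB : ∀ x, ∀ b ∈ B x, ∀ b' ∈ B x, b.toMatrix b' ∈ 𝔤)
    {S : TangentSpace 𝓘(ℝ, E) x →L[ℝ] TangentSpace 𝓘(ℝ, E) x} (hS : S ∈ adjointFibre 𝔤 B x)
    {b : Basis ι ℝ (TangentSpace 𝓘(ℝ, E) x)} (hb : b ∈ B x) :
    LinearMap.toMatrix b b (S : TangentSpace 𝓘(ℝ, E) x →ₗ[ℝ] _) ∈ 𝔤 := by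
  obtain ⟨b', hb', hS⟩ := hS
  rw [← basis_toMatrix_mul_linearMap_toMatrix_mul_basis_toMatrix b b' b b']
  exact hmul _ (hmul _ (hB x b hb b' hb') _ hS) _ (hB x b' hb' b hb)

/-! ### The trace condition at a point -/

/-- The torsion of `cov` satisfies the trace condition of the well-adapted connection at `x`. -/
def TorsionTraceZeroAt (𝔤 : LieSubalgebra ℝ (Matrix ι ι ℝ)) (B : FrameFamily E M ι)
    (cov : LinearConnection E M) (x : M) : Prop :=
  ∀ S ∈ adjointFibre 𝔤 B x, ∀ X : TangentSpace 𝓘(ℝ, E) x,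
    LinearMap.trace ℝ (TangentSpace 𝓘(ℝ, E) x)
      ((S ∘L cov.torsion x X : TangentSpace 𝓘(ℝ, E) x →L[ℝ] TangentSpace 𝓘(ℝ, E) x) :
        TangentSpace 𝓘(ℝ, E) x →ₗ[ℝ] TangentSpace 𝓘(ℝ, E) x) = 0

/-- Each `A ∈ 𝔤` is the matrix in `b` of an element of the adjoint fibre. The geometric condition
thus becomes the linear system for the connection form. -/
theorem TorsionTraceZeroAt.trace_mul_toMatrix {cov : LinearConnection E M}
    (h : TorsionTraceZeroAt 𝔤 B cov x) {b : Basis ι ℝ (TangentSpace 𝓘(ℝ, E) x)} (hb : b ∈ B x)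
    {A : Matrix ι ι ℝ} (hA : A ∈ 𝔤) (k : ι) :
    (A * LinearMap.toMatrix b b
      (cov.torsion x (b k) : TangentSpace 𝓘(ℝ, E) x →ₗ[ℝ] _)).trace = 0 := by
  have hS : LinearMap.toMatrix b b (LinearMap.toContinuousLinearMap (Matrix.toLin b b A) :
      TangentSpace 𝓘(ℝ, E) x →ₗ[ℝ] TangentSpace 𝓘(ℝ, E) x) = A := by
    simp
  have := h _ ⟨b, hb, hS.symm ▸ hA⟩ (b k)
  rwa [trace_comp_eq_trace_toMatrix_mul b, hS] at this

theorem torsionTraceZeroAt_of_basis (hmul : ∀ A ∈ 𝔤, ∀ A' ∈ 𝔤, A * A' ∈ 𝔤)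
    (hB : ∀ x, ∀ b ∈ B x, ∀ b' ∈ B x, b.toMatrix b' ∈ 𝔤) {cov : LinearConnection E M}
    {b : Basis ι ℝ (TangentSpace 𝓘(ℝ, E) x)} (hb : b ∈ B x)
    (h : ∀ A ∈ 𝔤, ∀ k, (A * LinearMap.toMatrix b b
      (cov.torsion x (b k) : TangentSpace 𝓘(ℝ, E) x →ₗ[ℝ] _)).trace = 0) :
    TorsionTraceZeroAt 𝔤 B cov x := by
  intro S hS X
  rw [trace_comp_eq_trace_toMatrix_mul b, ← b.sum_repr X]
  simp only [map_sum, map_smul, ContinuousLinearMap.toLinearMap_sum, ContinuousLinearMap.toLinearMap_smul,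
    Finset.mul_sum, Matrix.mul_smul, Matrix.trace_sum, Matrix.trace_smul]
  refine Finset.sum_eq_zero fun k _ => ?_
  rw [h _ (toMatrix_mem_of_mem_adjointFibre hmul hB hS hb) k, smul_zero]

end WellAdapted

section WellAdapted

open Bundle Module Filter VectorField
open scoped Topology

variable {E : Type*} [NormedAddCommGroup E] [NormedSpace ℝ E] [FiniteDimensional ℝ E]
  [CompleteSpace E]
  {M : Type*} [TopologicalSpace M] [ChartedSpace E M] [IsManifold 𝓘(ℝ, E) ∞ M]
  {ι : Type*} [Fintype ι] [DecidableEq ι] {B B' : FrameFamily E M ι} {U U' : Set M} {x : M}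
  {e e' : ι → Π x : M, TangentSpace 𝓘(ℝ, E) x} {𝔤 : LieSubalgebra ℝ (Matrix ι ι ℝ)}
  {Λ : (ι → Matrix ι ι ℝ) →ₗ[ℝ] (ι → Matrix ι ι ℝ)}

/-! ### Smoothness of the connection of a frame -/

omit [FiniteDimensional ℝ E] [Fintype ι] [DecidableEq ι] in
theorem contMDiffAt_mlieBracket {X Y : Π x : M, TangentSpace 𝓘(ℝ, E) x}
    (hX : CMDiffAt ∞ (T% X) x) (hY : CMDiffAt ∞ (T% Y) x) :
    CMDiffAt ∞ (T% (mlieBracket 𝓘(ℝ, E) X Y)) x := by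
  have : IsManifold 𝓘(ℝ, E) (((⊤ : ℕ∞) : ℕ∞ω) + 1) M := by simpa using! ‹IsManifold 𝓘(ℝ, E) ∞ M›
  have : IsManifold 𝓘(ℝ, E) (minSmoothness ℝ 2) M := by
    rw [minSmoothness_of_isRCLikeNormedField]
    infer_instance
  exact ContMDiffAt.mlieBracket_vectorField (m := ⊤) (n := ⊤) hX hY (by simp)

omit [FiniteDimensional ℝ E] [Fintype ι] [DecidableEq ι] in
/-- The field `X(f) Y` is smooth, because it equals `[X, f Y] - f [X, Y]`. -/
theorem contMDiffAt_mvfderiv_apply_smul (hU : IsOpen U) (hx : x ∈ U) {f : M → ℝ}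
    {X Y : Π x : M, TangentSpace 𝓘(ℝ, E) x} (hf : CMDiff[U] ∞ f) (hX : CMDiff[U] ∞ (T% X))
    (hY : CMDiff[U] ∞ (T% Y)) :
    CMDiffAt ∞ (T% fun y => d% f y (X y) • Y y) x := by
  have hU' := hU.mem_nhds hx
  have h1 := contMDiffAt_mlieBracket (hX.contMDiffAt hU')
    ((hf.contMDiffAt hU').smul_section (hY.contMDiffAt hU'))
  have h2 := (hf.contMDiffAt hU').smul_section
    (contMDiffAt_mlieBracket (hX.contMDiffAt hU') (hY.contMDiffAt hU'))
  refine (h1.sub_section h2).congr_of_eventuallyEq ?_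
  filter_upwards [hU'] with y hy
  have h3 := mlieBracket_smul_right (I := 𝓘(ℝ, E)) (V := X)
    ((hf.contMDiffAt (hU.mem_nhds hy)).mdifferentiableAt (by simp))
    ((hY.contMDiffAt (hU.mem_nhds hy)).mdifferentiableAt (by simp))
  rw [Pi.sub_apply, h3]
  simp

theorem contMDiffAt_frameCov (hs : IsLocalFrameOn 𝓘(ℝ, E) E ∞ e U) (hU : IsOpen U) (hx : x ∈ U)
    {σ : Π x : M, TangentSpace 𝓘(ℝ, E) x} (hσ : CMDiff[U] ∞ (T% σ)) :
    ContMDiffAt 𝓘(ℝ, E) (𝓘(ℝ, E).prod 𝓘(ℝ, E →L[ℝ] E)) ∞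
      (fun y => TotalSpace.mk' (E →L[ℝ] E)
        (E := fun y : M => TangentSpace 𝓘(ℝ, E) y →L[ℝ] TangentSpace 𝓘(ℝ, E) y) y
        (frameCov Λ hs σ y)) x := by
  have hcoeff : ∀ {τ : Π x : M, TangentSpace 𝓘(ℝ, E) x}, CMDiff[U] ∞ (T% τ) → ∀ j,
      CMDiff[U] ∞ (fun y => hs.coeff j y (τ y)) := fun hτ j y hy =>
    (hs.contMDiffAt_coeff (hU.mem_nhds hy) (hτ.contMDiffAt (hU.mem_nhds hy)) j).contMDiffWithinAt
  have hU' := hU.mem_nhds hx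
  have hstruct : ContMDiffAt 𝓘(ℝ, E) 𝓘(ℝ, ι → ι → ι → ℝ) ∞
      (fun y k i j => structureMatrix hs y k i j) x := by
    refine contMDiffAt_pi_space.2 fun k => contMDiffAt_pi_space.2 fun i =>
      contMDiffAt_pi_space.2 fun j => ?_
    exact hs.contMDiffAt_coeff hU' (contMDiffAt_mlieBracket ((hs.contMDiffOn k).contMDiffAt hU')
      ((hs.contMDiffOn j).contMDiffAt hU')) i
  have hΛ : ∀ k i j, CMDiffAt ∞ (fun y => Λ (structureMatrix hs y) k i j) x := by
    intro k i j
    -- One entry of `Λ` as a linear functional of the structure functions; it is continuous, hence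
    -- smooth.
    let L : (ι → ι → ι → ℝ) →ₗ[ℝ] ℝ :=
      { toFun := fun c => Λ (fun k => Matrix.of (c k)) k i j
        map_add' := fun c c' => by
          have : (fun k => Matrix.of ((c + c') k)) =
              (fun k => Matrix.of (c k)) + fun k => Matrix.of (c' k) := rfl
          rw [this, map_add]
          rfl
        map_smul' := fun r c => by
          have : (fun k => Matrix.of ((r • c) k)) = r • fun k => Matrix.of (c k) := rfl
          rw [this, map_smul]
          rfl }
    exact (LinearMap.toContinuousLinearMap L).contMDiff.contMDiffAt.comp x hstruct
  refine hs.contMDiffAt_hom hU' fun k => ?_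
  have h : CMDiffAt ∞ (T% fun y => ∑ j, (d% (fun z => hs.coeff j z (σ z)) y (e k y) • e j y +
      hs.coeff j y (σ y) • ∑ i, Λ (structureMatrix hs y) k i j • e i y)) x := by
    refine ContMDiffAt.sum_section fun j _ => ?_
    refine ContMDiffAt.add_section (s := fun y => d% (fun z => hs.coeff j z (σ z)) y (e k y) • e j y)
      (contMDiffAt_mvfderiv_apply_smul hU hx (hcoeff hσ j)
      (hs.contMDiffOn k) (hs.contMDiffOn j)) ?_
    refine ContMDiffAt.smul_section (s := fun y => ∑ i, Λ (structureMatrix hs y) k i j • e i y) ((hcoeff hσ j).contMDiffAt hU') ?_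
    refine ContMDiffAt.sum_section fun i _ => ?_
    exact (hΛ k i j).smul_section ((hs.contMDiffOn i).contMDiffAt hU')
  refine h.congr_of_eventuallyEq ?_
  filter_upwards [hU'] with y hy
  have hke : ∀ l, hs.coeff l y (e k y) = if l = k then 1 else 0 := by
    intro l
    rw [hs.coeff_apply_of_mem hy, ← hs.toBasisAt_coe hy, Basis.repr_self, Finsupp.single_apply]
    simp only [eq_comm]
  simp [frameCov, hke]

/-! ### The global connection -/

/-- A smooth local section of `B` near the point `x`. -/
structure AdaptedFrame (B : FrameFamily E M ι) (x : M) where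
  /-- The domain of the section. -/
  domain : Set M
  /-- The section. -/
  frame : ι → Π y : M, TangentSpace 𝓘(ℝ, E) y
  isOpen : IsOpen domain
  mem : x ∈ domain
  isLocalSection : IsLocalSection B domain frame

/-- The connection which at each point `x` is given by the solution `Λ` of the trace condition in
a given local frame of `B` near `x`. -/
def gluedConnection (Λ : (ι → Matrix ι ι ℝ) →ₗ[ℝ] (ι → Matrix ι ι ℝ))
    (𝓔 : ∀ x, AdaptedFrame B x) : LinearConnection E M where
  toFun σ x := frameCov Λ (𝓔 x).isLocalSection.isLocalFrameOn σ x
  isCovariantDerivativeOnUniv :=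
    { add := fun {_ _ x} hσ hσ' _ =>
        (isCovariantDerivativeOn_frameCov _ (𝓔 x).isOpen).add hσ hσ' (𝓔 x).mem
      leibniz := fun {_ _ x} hσ hg _ =>
        (isCovariantDerivativeOn_frameCov _ (𝓔 x).isOpen).leibniz hσ hg (𝓔 x).mem }

variable (hmul : ∀ A ∈ 𝔤, ∀ A' ∈ 𝔤, A * A' ∈ 𝔤)
  (hB : ∀ x, ∀ b ∈ B x, ∀ b' ∈ B x, b.toMatrix b' ∈ 𝔤)
  (hΛ : ∀ c, (∀ k, Λ c k ∈ 𝔤) ∧ ∀ A ∈ 𝔤, ∀ k, (A * (alternation ι (Λ c) k - c k)).trace = 0)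

omit [CompleteSpace E] in
include hmul hB hΛ in
theorem isAdapted_gluedConnection (𝓔 : ∀ x, AdaptedFrame B x) :
    IsAdapted 𝔤 B (gluedConnection Λ 𝓔) := by
  intro U e hU he x hx v
  refine exists_apply_frame_eq hmul hB ((𝓔 x).isOpen.mem_nhds (𝓔 x).mem) (𝓔 x).isLocalSection
    (hU.mem_nhds hx) he (fun v => ⟨_, ?_, fun j => frameCov_apply_frame _
      ((𝓔 x).isOpen.mem_nhds (𝓔 x).mem) j v⟩) v
  exact 𝔤.toSubmodule.sum_mem fun k _ => 𝔤.smul_mem _ ((hΛ _).1 k)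

include hmul hB hΛ in
theorem torsionTraceZeroAt_gluedConnection (𝓔 : ∀ x, AdaptedFrame B x) (x : M) :
    TorsionTraceZeroAt 𝔤 B (gluedConnection Λ 𝓔) x := by
  have hU := (𝓔 x).isOpen.mem_nhds (𝓔 x).mem
  obtain ⟨b, hb, hbe⟩ := (𝓔 x).isLocalSection.2 x (𝓔 x).mem
  have hs := (𝓔 x).isLocalSection.isLocalFrameOn
  refine torsionTraceZeroAt_of_basis hmul hB hb fun A hA k => ?_
  rw [toMatrix_torsion _ hs hU hbe (W := Λ (structureMatrix hs x))]
  · exact (hΛ _).2 A hA k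
  · intro k j
    refine (frameCov_apply_frame hs hU j _).trans ?_
    have hke : ∀ l, hs.coeff l x ((𝓔 x).frame k x) = if l = k then 1 else 0 := by
      intro l
      rw [hs.coeff_apply_of_mem (𝓔 x).mem, ← hs.toBasisAt_coe (𝓔 x).mem, Basis.repr_self,
        Finsupp.single_apply]
      simp only [eq_comm]
    simp [frameForm, hke]

/-- Two connections adapted to `B` whose torsions satisfy the trace condition at `x` agree at
`x`. -/
theorem connectionEqAt_of_torsionTraceZeroAt (h𝔤 : firstProlongation 𝔤 = ⊥)
    (htr : ∀ A ∈ 𝔤, Aᵀ ∈ 𝔤) {cov cov' : LinearConnection E M} (hU : IsOpen U) (hx : x ∈ U)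
    (he : IsLocalSection B U e) (hcov : IsAdapted 𝔤 B cov) (hcov' : IsAdapted 𝔤 B cov')
    (hT : TorsionTraceZeroAt 𝔤 B cov x) (hT' : TorsionTraceZeroAt 𝔤 B cov' x) :
    ConnectionEqAt cov cov' x := by
  obtain ⟨b, hb, hbe⟩ := he.2 x hx
  exact connectionEqAt_of_frame he.isLocalFrameOn (hU.mem_nhds hx)
    (apply_frame_eq_of_trace_eq_zero h𝔤 htr he.isLocalFrameOn (hU.mem_nhds hx) hbe
      (hcov U e hU he x hx) (hcov' U e hU he x hx) (fun A hA k => hT.trace_mul_toMatrix hb hA k)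
      fun A hA k => hT'.trace_mul_toMatrix hb hA k)

include hmul hB hΛ in
-- The frames `𝓔 x` are chosen independently at each point. Near `x₀`, uniqueness lets the frame at
-- `x₀` replace all the others, and a single smooth frame gives a smooth connection.
theorem contMDiff_gluedConnection (h𝔤 : firstProlongation 𝔤 = ⊥)
    (htr : ∀ A ∈ 𝔤, Aᵀ ∈ 𝔤) (𝓔 : ∀ x, AdaptedFrame B x) :
    (gluedConnection Λ 𝓔).ContMDiffCovariantDerivative ∞ := by
  classical
  refine ⟨⟨fun {σ} hσ x₀ _ => ?_⟩⟩
  have hσ : CMDiff ∞ (T% σ) := by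
    rw [← contMDiffOn_univ]
    exact hσ.of_le (by simp)
  let f := 𝓔 x₀
  -- This choice uses one fixed frame throughout the domain of `f`; by uniqueness it glues to the
  -- same connection.
  let 𝓔' : ∀ x, AdaptedFrame B x := fun x =>
    if hx : x ∈ f.domain then ⟨f.domain, f.frame, f.isOpen, hx, f.isLocalSection⟩ else 𝓔 x
  have hev : ∀ y ∈ f.domain, gluedConnection Λ 𝓔 σ y =
      frameCov Λ f.isLocalSection.isLocalFrameOn σ y := by
    intro y hy
    have h1 := connectionEqAt_of_torsionTraceZeroAt h𝔤 htr f.isOpen hy f.isLocalSection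
      (isAdapted_gluedConnection hmul hB hΛ 𝓔) (isAdapted_gluedConnection hmul hB hΛ 𝓔')
      (torsionTraceZeroAt_gluedConnection hmul hB hΛ 𝓔 y)
      (torsionTraceZeroAt_gluedConnection hmul hB hΛ 𝓔' y) σ
      (hσ.contMDiffAt.mdifferentiableAt (by simp))
    rw [h1]
    have h2 : 𝓔' y = ⟨f.domain, f.frame, f.isOpen, hy, f.isLocalSection⟩ := dif_pos hy
    change frameCov Λ (𝓔' y).isLocalSection.isLocalFrameOn σ y = _
    rw [h2]
  refine ContMDiffAt.contMDiffWithinAt ?_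
  refine (contMDiffAt_frameCov (Λ := Λ) f.isLocalSection.isLocalFrameOn f.isOpen f.mem
    hσ.contMDiffOn).congr_of_eventuallyEq ?_
  filter_upwards [f.isOpen.mem_nhds f.mem] with y hy
  rw [hev y hy]

end WellAdapted

section WellAdapted

open Bundle Module Filter VectorField
open scoped Topology

variable {E : Type*} [NormedAddCommGroup E] [NormedSpace ℝ E] [FiniteDimensional ℝ E]
  [CompleteSpace E]
  {M : Type*} [TopologicalSpace M] [ChartedSpace E M] [IsManifold 𝓘(ℝ, E) ∞ M]
  {ι : Type*} [Fintype ι] [DecidableEq ι] {B B' : FrameFamily E M ι} {U U' : Set M} {x : M}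
  {e e' : ι → Π x : M, TangentSpace 𝓘(ℝ, E) x} {𝔤 : LieSubalgebra ℝ (Matrix ι ι ℝ)}

/-! ### Local fields of endomorphisms -/

/-- The field of endomorphisms with constant matrix `A` in a frame. -/
def frameEndomorphism (hs : IsLocalFrameOn 𝓘(ℝ, E) E ∞ e U) (A : Matrix ι ι ℝ) (x : M) :
    TangentSpace 𝓘(ℝ, E) x →L[ℝ] TangentSpace 𝓘(ℝ, E) x :=
  ∑ j, (LinearMap.toContinuousLinearMap (hs.coeff j x)).smulRight (∑ i, A i j • e i x)

omit [CompleteSpace E] in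
theorem frameEndomorphism_apply_frame (hs : IsLocalFrameOn 𝓘(ℝ, E) E ∞ e U) (A : Matrix ι ι ℝ)
    (hx : x ∈ U) (j : ι) : frameEndomorphism hs A x (e j x) = ∑ i, A i j • e i x := by
  have hke : ∀ l, hs.coeff l x (e j x) = if l = j then 1 else 0 := by
    intro l
    rw [hs.coeff_apply_of_mem hx, ← hs.toBasisAt_coe hx, Basis.repr_self, Finsupp.single_apply]
    simp only [eq_comm]
  simp [frameEndomorphism, hke]

omit [CompleteSpace E] in
theorem toMatrix_frameEndomorphism (hs : IsLocalFrameOn 𝓘(ℝ, E) E ∞ e U) (A : Matrix ι ι ℝ)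
    (hx : x ∈ U) {b : Basis ι ℝ (TangentSpace 𝓘(ℝ, E) x)} (hb : ∀ i, b i = e i x) :
    LinearMap.toMatrix b b
      (frameEndomorphism hs A x : TangentSpace 𝓘(ℝ, E) x →ₗ[ℝ] TangentSpace 𝓘(ℝ, E) x) = A := by
  ext i j
  rw [LinearMap.toMatrix_apply, ContinuousLinearMap.coe_coe, hb j,
    frameEndomorphism_apply_frame hs A hx]
  simp only [← hb, map_sum, map_smul, Basis.repr_self]
  simp [Finsupp.single_apply]

omit [CompleteSpace E] in
theorem contMDiffOn_frameEndomorphism (hs : IsLocalFrameOn 𝓘(ℝ, E) E ∞ e U) (hU : IsOpen U)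
    (A : Matrix ι ι ℝ) :
    ContMDiffOn 𝓘(ℝ, E) (𝓘(ℝ, E).prod 𝓘(ℝ, E →L[ℝ] E)) ∞
      (fun y => TotalSpace.mk' (E →L[ℝ] E)
        (E := fun y : M => TangentSpace 𝓘(ℝ, E) y →L[ℝ] TangentSpace 𝓘(ℝ, E) y) y
        (frameEndomorphism hs A y)) U := by
  intro y hy
  refine (hs.contMDiffAt_hom (hU.mem_nhds hy) fun j => ?_).contMDiffWithinAt
  have h : CMDiffAt ∞ (T% fun y => ∑ i, A i j • e i y) y :=
    ContMDiffAt.sum_section fun i _ =>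
      ((hs.contMDiffOn i).contMDiffAt (hU.mem_nhds hy)).const_smul_section
  refine h.congr_of_eventuallyEq ?_
  filter_upwards [hU.mem_nhds hy] with z hz
  simp [frameEndomorphism_apply_frame hs A hz]

/-- The condition is imposed on global fields only. An endomorphism and a vector at `x` extend with
constant coefficients in the frame, cut off by a bump function. Outside `U` the zero endomorphism is
in the adjoint fibre because `B` has a frame there. -/
theorem IsWellAdapted.torsionTraceZeroAt [T2Space M]
    (hmul : ∀ A ∈ 𝔤, ∀ A' ∈ 𝔤, A * A' ∈ 𝔤)
    (hB : ∀ x, ∀ b ∈ B x, ∀ b' ∈ B x, b.toMatrix b' ∈ 𝔤)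
    (hne : ∀ x, (B x).Nonempty) {cov : LinearConnection E M} (h : IsWellAdapted 𝔤 B cov)
    (hU : IsOpen U) (hx : x ∈ U) (he : IsLocalSection B U e) :
    TorsionTraceZeroAt 𝔤 B cov x := by
  intro S₀ hS₀ X₀
  have hs := he.isLocalFrameOn
  obtain ⟨b, hb, hbe⟩ := he.2 x hx
  let A := LinearMap.toMatrix b b (S₀ : TangentSpace 𝓘(ℝ, E) x →ₗ[ℝ] _)
  have hA : A ∈ 𝔤 := toMatrix_mem_of_mem_adjointFibre hmul hB hS₀ hb
  obtain ⟨ψ, hψ, -⟩ := (SmoothBumpFunction.nhds_basis_support (I := 𝓘(ℝ, E))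
    (hU.mem_nhds hx)).mem_iff.1 (hU.mem_nhds hx)
  have hψ1 : ψ x = 1 := ψ.eq_one
  have hψ0 : ∀ y, y ∉ U → ψ y = 0 := fun y hy =>
    image_eq_zero_of_notMem_tsupport fun h => hy (hψ h)
  have hSsmooth : IsSmoothEndomorphism ((ψ : M → ℝ) • frameEndomorphism hs A) :=
    ContMDiffOn.smul_section_of_tsupport ψ.contMDiff.contMDiffOn hU hψ
      (contMDiffOn_frameEndomorphism hs hU A)
  have hSmem : ∀ y, ((ψ : M → ℝ) • frameEndomorphism hs A) y ∈ adjointFibre 𝔤 B y := by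
    intro y
    by_cases hy : y ∈ U
    · obtain ⟨c, hc, hce⟩ := he.2 y hy
      refine ⟨c, hc, ?_⟩
      rw [Pi.smul_apply', ContinuousLinearMap.toLinearMap_smul, map_smul,
        toMatrix_frameEndomorphism hs A hy hce]
      exact 𝔤.smul_mem _ hA
    · obtain ⟨c, hc⟩ := hne y
      refine ⟨c, hc, ?_⟩
      rw [Pi.smul_apply', hψ0 y hy, zero_smul, ContinuousLinearMap.toLinearMap_zero, map_zero]
      exact 𝔤.zero_mem
  have hXsmooth : CMDiff ∞ (T% ((ψ : M → ℝ) • fun y => ∑ i, b.repr X₀ i • e i y)) :=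
    ContMDiffOn.smul_section_of_tsupport ψ.contMDiff.contMDiffOn hU hψ
      (ContMDiffOn.sum_section fun i _ => (hs.contMDiffOn i).const_smul_section)
  have hfinal := h.trace_eq_zero _ hSsmooth hSmem _ hXsmooth x
  have hX : ((ψ : M → ℝ) • fun y => ∑ i, b.repr X₀ i • e i y) x = X₀ := by
    rw [Pi.smul_apply', hψ1, one_smul]
    simp only [← hbe]
    exact b.sum_repr X₀
  have hS : ((ψ : M → ℝ) • frameEndomorphism hs A) x = S₀ := by
    rw [Pi.smul_apply', hψ1, one_smul]
    refine ContinuousLinearMap.coe_injective ((LinearMap.toMatrix b b).injective ?_)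
    exact toMatrix_frameEndomorphism hs A hx hbe
  rw [hX, hS] at hfinal
  exact hfinal

/-! ### Dependence on first contact -/

omit [FiniteDimensional ℝ E] [CompleteSpace E] [DecidableEq ι] in
-- Viewed on the tangent bundle, the coefficients compose with a section, so the chain rule
-- expresses their derivatives through the `mfderiv` of that section.
theorem IsLocalFrameOn.mdifferentiableAt_coeff_totalSpace
    (hs : IsLocalFrameOn 𝓘(ℝ, E) E ∞ e U) (hU : U ∈ 𝓝 x) (v : TangentSpace 𝓘(ℝ, E) x) (i : ι) :
    MDiffAt (fun p : TangentBundle 𝓘(ℝ, E) M => hs.coeff i p.1 p.2) ⟨x, v⟩ := by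
  have hx := mem_of_mem_nhds hU
  have h1 := contMDiffAt_inverse_frameMap (𝕜 := ℝ) (F := E) (I := 𝓘(ℝ, E)) (k := ∞)
    (fun i => (hs.contMDiffOn i).contMDiffAt hU)
    (hs.toBasisAt hx) (hs.toBasisAt_coe hx)
  have hproj : ContMDiffAt 𝓘(ℝ, E).tangent 𝓘(ℝ, E) ∞
      (TotalSpace.proj : TangentBundle 𝓘(ℝ, E) M → M) ⟨x, v⟩ := contMDiffAt_proj _
  have h2 : ContMDiffAt 𝓘(ℝ, E).tangent 𝓘(ℝ, E →L[ℝ] (ι → ℝ)) ∞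
      (fun p : TangentBundle 𝓘(ℝ, E) M => (frameMap ℝ E x e p.1).inverse) ⟨x, v⟩ :=
    ContMDiffAt.comp _ (g := fun y => (frameMap ℝ E x e y).inverse) h1 hproj
  have h3 : ContMDiffAt 𝓘(ℝ, E).tangent 𝓘(ℝ, E) ∞
      (fun p : TangentBundle 𝓘(ℝ, E) M => (trivializationAt E (TangentSpace 𝓘(ℝ, E)) x p).2)
      ⟨x, v⟩ := 
    (((trivializationAt E (TangentSpace 𝓘(ℝ, E)) x).contMDiffOn (IB := 𝓘(ℝ, E)) (n := ∞)).contMDiffAt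
      ((trivializationAt E (TangentSpace 𝓘(ℝ, E)) x).open_source.mem_nhds
        ((trivializationAt E (TangentSpace 𝓘(ℝ, E)) x).mem_source.2
          (FiberBundle.mem_baseSet_trivializationAt' x)))).snd
  have h4 : ContMDiffAt 𝓘(ℝ, E).tangent 𝓘(ℝ) ∞ (fun p : TangentBundle 𝓘(ℝ, E) M =>
      (frameMap ℝ E x e p.1).inverse (trivializationAt E (TangentSpace 𝓘(ℝ, E)) x p).2 i)
      ⟨x, v⟩ :=
    (ContinuousLinearMap.proj (R := ℝ) (φ := fun _ : ι => ℝ) i).contMDiff.contMDiffAt.comp _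
      (h2.clm_apply h3)
  refine (h4.mdifferentiableAt (by simp)).congr_of_eventuallyEq ?_
  have hN : U ∩ (trivializationAt E (TangentSpace 𝓘(ℝ, E)) x).baseSet ∈ 𝓝 x :=
    inter_mem hU ((trivializationAt E (TangentSpace 𝓘(ℝ, E)) x).open_baseSet.mem_nhds
      (FiberBundle.mem_baseSet_trivializationAt' x))
  filter_upwards [hproj.continuousAt.preimage_mem_nhds hN] with p hp
  obtain ⟨y, w⟩ := p
  rw [inverse_frameMap_apply hp.2 (hs.toBasisAt hp.1) (hs.toBasisAt_coe hp.1)]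
  simp only [IsLocalFrameOn.coeff]
  rw [dif_pos hp.1]
  rfl

omit [FiniteDimensional ℝ E] [CompleteSpace E] [DecidableEq ι] in
/-- The value of a connection on a vector field at `x` depends only on the 1-jet of the field. -/
theorem LinearConnection.apply_eq_of_mfderiv_eq (cov : LinearConnection E M)
    (hs : IsLocalFrameOn 𝓘(ℝ, E) E ∞ e U) (hU : U ∈ 𝓝 x)
    {σ σ' : Π x : M, TangentSpace 𝓘(ℝ, E) x} (hσ : MDiffAt (T% σ) x) (hσ' : MDiffAt (T% σ') x)
    (h0 : σ x = σ' x)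
    (h1 : mfderiv 𝓘(ℝ, E) 𝓘(ℝ, E).tangent (fun y => (⟨y, σ y⟩ : TangentBundle 𝓘(ℝ, E) M)) x =
      mfderiv 𝓘(ℝ, E) 𝓘(ℝ, E).tangent (fun y => (⟨y, σ' y⟩ : TangentBundle 𝓘(ℝ, E) M)) x) :
    cov σ x = cov σ' x := by
  rw [cov.apply_eq_sum_coeff hs hU hσ, cov.apply_eq_sum_coeff hs hU hσ']
  refine Finset.sum_congr rfl fun i _ => ?_
  let G : TangentBundle 𝓘(ℝ, E) M → ℝ := fun p => hs.coeff i p.1 p.2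
  -- Giving `D` values in one fixed space of functionals permits replacing `σ x` by `σ' x`.
  let D : TangentBundle 𝓘(ℝ, E) M → (E × E →L[ℝ] ℝ) := fun p => mvfderiv 𝓘(ℝ, E).tangent G p
  have key : ∀ {τ : Π x : M, TangentSpace 𝓘(ℝ, E) x}, MDiffAt (T% τ) x →
      d% (fun y => hs.coeff i y (τ y)) x = (D ⟨x, τ x⟩).comp
        (mfderiv 𝓘(ℝ, E) 𝓘(ℝ, E).tangent (fun y => (⟨y, τ y⟩ : TangentBundle 𝓘(ℝ, E) M)) x) :=
    fun {τ} hτ => mvfderiv_comp x (f := fun y => (⟨y, τ y⟩ : TangentBundle 𝓘(ℝ, E) M))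
      (hs.mdifferentiableAt_coeff_totalSpace hU (τ x) i) hτ
  rw [key hσ, key hσ', h0]
  congr 3

/-- Since `e` and `e'` have the same 1-jet at `x`, `cov'` takes the same values on both there. Its
form in the frame `e` is thus `𝔤`-valued at `x`, and pointwise uniqueness applies to both
connections in this one frame. -/
theorem connectionEqAt_of_sameFirstContact [T2Space M] (h𝔤 : firstProlongation 𝔤 = ⊥)
    (htr : ∀ A ∈ 𝔤, Aᵀ ∈ 𝔤) {cov cov' : LinearConnection E M} (hcov : IsAdapted 𝔤 B cov)
    (hcov' : IsAdapted 𝔤 B' cov') (hT : TorsionTraceZeroAt 𝔤 B cov x)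
    (hT' : TorsionTraceZeroAt 𝔤 B' cov' x) (hBB' : SameFirstContact B B' x) :
    ConnectionEqAt cov cov' x := by
  obtain ⟨U, hU, hx, e, e', he, he', hee'⟩ := hBB'
  obtain ⟨b, hb, hbe⟩ := he.2 x hx
  obtain ⟨b', hb', hbe'⟩ := he'.2 x hx
  have hbb' : b' = b := by
    ext1 i
    rw [hbe, hbe', (hee' i).1]
  subst hbb'
  have hU' := hU.mem_nhds hx
  have hs := he.isLocalFrameOn
  refine connectionEqAt_of_frame hs hU' (apply_frame_eq_of_trace_eq_zero h𝔤 htr hs hU' hbe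
    (hcov U e hU he x hx) ?_ (fun A hA k => hT.trace_mul_toMatrix hb hA k)
    fun A hA k => hT'.trace_mul_toMatrix hb' hA k)
  intro v
  obtain ⟨W, hW, h⟩ := hcov' U e' hU he' x hx v
  refine ⟨W, hW, fun j => ?_⟩
  rw [cov'.apply_eq_of_mfderiv_eq hs hU' (hs.mdifferentiableAt hU' j)
    (he'.isLocalFrameOn.mdifferentiableAt hU' j) (hee' j).1 (hee' j).2, h]
  simp only [(hee' _).1]

end WellAdapted

/-! ### Anticommuting involutions -/

section Involutions

open Module

variable {V : Type*} [AddCommGroup V] [Module ℝ V] {F P : V →ₗ[ℝ] V} {n : ℕ}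

/-- A basis of the form `(X_1, …, X_n, P X_1, …, P X_n)` with `F X_i = X_i`. -/
theorem exists_basis_of_anticommuting_involutions [FiniteDimensional ℝ V]
    (hV : finrank ℝ V = 2 * n) (hF : ∀ v, F (F v) = v) (hP : ∀ v, P (P v) = v)
    (hFP : ∀ v, F (P v) + P (F v) = 0) :
    ∃ b : Basis (Fin n ⊕ Fin n) ℝ V, ∀ i, F (b (.inl i)) = b (.inl i) ∧
      P (b (.inl i)) = b (.inr i) := by
  have hFP' : ∀ v, F (P v) = -P (F v) := fun v => eq_neg_of_add_eq_zero_left (hFP v)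
  let K : Submodule ℝ V := LinearMap.ker (F - LinearMap.id)
  have hK : ∀ v, v ∈ K ↔ F v = v := fun v => by simp [K, sub_eq_zero]
  let toK : V →ₗ[ℝ] K := ((1 / 2 : ℝ) • (LinearMap.id + F)).codRestrict K fun v => by
    rw [hK]
    simp [hF, add_comm]
  have htoK : ∀ v, (toK v : V) = (1 / 2 : ℝ) • (v + F v) := fun v => rfl
  -- The map `(X, Y) ↦ X + P Y`: as `P` exchanges the eigenspaces of `F`, its inverse is given by
  -- the projection `(1 + F)/2` applied to `v` and to `P v`.
  let φ : (K × K) ≃ₗ[ℝ] V := LinearEquiv.ofLinearMap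
    (K.subtype.coprod (P ∘ₗ K.subtype)) (toK.prod (toK ∘ₗ P))
    (by
      refine LinearMap.ext fun v => ?_
      change (toK v : V) + P (toK (P v) : V) = v
      simp only [htoK, map_smul, map_add, hP, hFP', map_neg]
      module)
    (by
      refine LinearMap.ext fun p => ?_
      have h1 := (hK _).1 p.1.2
      have h2 := (hK _).1 p.2.2
      refine Prod.ext (Subtype.ext ?_) (Subtype.ext ?_)
      · change (toK ((p.1 : V) + P (p.2 : V)) : V) = p.1
        rw [htoK]
        simp only [map_add, hFP', h1, h2]
        module
      · change (toK (P ((p.1 : V) + P (p.2 : V))) : V) = p.2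
        rw [htoK]
        simp only [map_add, hFP', hP, h1, h2]
        module)
  have hfin : finrank ℝ K = n := by
    have := φ.finrank_eq
    rw [finrank_prod] at this
    lia
  let v : Basis (Fin n) ℝ K := finBasisOfFinrankEq ℝ K hfin
  refine ⟨(v.prod v).map φ, fun i => ?_⟩
  have hl : (v.prod v).map φ (.inl i) = v i := by simp [φ]
  have hr : (v.prod v).map φ (.inr i) = P (v i) := by simp [φ]
  rw [hl, hr]
  exact ⟨(hK _).1 (v i).2, rfl⟩

theorem repr_of_anticommuting_involutions (hFP : ∀ v, F (P v) + P (F v) = 0)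
    (hP : ∀ v, P (P v) = v)
    {b : Basis (Fin n ⊕ Fin n) ℝ V} (hb : ∀ i, F (b (.inl i)) = b (.inl i) ∧
      P (b (.inl i)) = b (.inr i)) (v : V) (i : Fin n) :
    b.repr (F v) (.inr i) = -b.repr v (.inr i) ∧ b.repr (P v) (.inl i) = b.repr v (.inr i) ∧
      b.repr (P v) (.inr i) = b.repr v (.inl i) := by
  have hFr : ∀ i, F (b (.inr i)) = -b (.inr i) := fun i => by
    have := hFP (b (.inl i))
    rw [(hb i).1, (hb i).2] at this
    exact eq_neg_of_add_eq_zero_left this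
  have hPr : ∀ i, P (b (.inr i)) = b (.inl i) := fun i => by rw [← (hb i).2, hP]
  have h1 : b.coord (.inr i) ∘ₗ F = -b.coord (.inr i) := by
    refine b.ext fun j => ?_
    rcases j with j | j <;> simp [hb, hFr]
  have h2 : b.coord (.inl i) ∘ₗ P = b.coord (.inr i) := by
    refine b.ext fun j => ?_
    rcases j with j | j <;> simp [hb, hPr, Finsupp.single_apply]
  have h3 : b.coord (.inr i) ∘ₗ P = b.coord (.inl i) := by
    refine b.ext fun j => ?_
    rcases j with j | j <;> simp [hb, hPr, Finsupp.single_apply]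
  exact ⟨LinearMap.congr_fun h1 v, LinearMap.congr_fun h2 v, LinearMap.congr_fun h3 v⟩

end Involutions

/-! ### `ΔGL(n, ℝ)`-structures -/

section DeltaStructures

open Bundle Module Filter
open scoped Topology

variable {E : Type*} [NormedAddCommGroup E] [NormedSpace ℝ E]
  {M : Type*} [TopologicalSpace M] [ChartedSpace E M] [IsManifold 𝓘(ℝ, E) ∞ M] {n : ℕ}

theorem IsGStructure.toMatrix_mem {B : FrameFamily E M (Fin n ⊕ Fin n)}
    (hB : IsGStructure (deltaGL n) B) (x : M) (b : Basis (Fin n ⊕ Fin n) ℝ (TangentSpace 𝓘(ℝ, E) x))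
    (hb : b ∈ B x) (b' : Basis (Fin n ⊕ Fin n) ℝ (TangentSpace 𝓘(ℝ, E) x)) (hb' : b' ∈ B x) :
    b.toMatrix b' ∈ deltaLie n := by
  obtain ⟨g, hg, hgb⟩ := (hB.orbit x b hb b').1 hb'
  have : b.toMatrix b' = g := by
    ext i j
    rw [Basis.toMatrix_apply, hgb, map_sum, Finsupp.finsetSum_apply]
    simp [Finsupp.single_apply]
  rw [this]
  exact mem_deltaGL_iff.1 hg

theorem IsGStructure.nonempty_adaptedFrame {ι : Type*} [Fintype ι] [DecidableEq ι]
    {G : Subgroup (Matrix.GeneralLinearGroup ι ℝ)} {B : FrameFamily E M ι}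
    (hB : IsGStructure G B) (x : M) : Nonempty (AdaptedFrame B x) := by
  obtain ⟨U, hU, hx, e, he⟩ := hB.exists_localSection x
  exact ⟨⟨U, e, hU, hx, he⟩⟩

theorem IsGStructure.frames_nonempty {ι : Type*} [Fintype ι] [DecidableEq ι]
    {G : Subgroup (Matrix.GeneralLinearGroup ι ℝ)} {B : FrameFamily E M ι}
    (hB : IsGStructure G B) (x : M) : (B x).Nonempty := by
  obtain ⟨f⟩ := hB.nonempty_adaptedFrame x
  obtain ⟨b, hb, -⟩ := f.isLocalSection.2 x f.mem
  exact ⟨b, hb⟩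

/-- For the transition matrix, `F X_i = X_i` kills the lower left block. As `P` exchanges the two
halves of the coordinates, `Y_i = P X_i` then kills the upper right block and makes the diagonal
blocks equal. -/
theorem AlmostBiparacomplex.mem_adaptedFrames_iff (A : AlmostBiparacomplex E M) (x : M)
    {b : Basis (Fin n ⊕ Fin n) ℝ (TangentSpace 𝓘(ℝ, E) x)} (hb : b ∈ A.adaptedFrames n x)
    (b' : Basis (Fin n ⊕ Fin n) ℝ (TangentSpace 𝓘(ℝ, E) x)) :
    b' ∈ A.adaptedFrames n x ↔ ∃ g ∈ deltaGL n, ∀ j,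
      b' j = ∑ i, (g : Matrix (Fin n ⊕ Fin n) (Fin n ⊕ Fin n) ℝ) i j • b i := by
  have hrepr := repr_of_anticommuting_involutions
    (F := (A.F x : TangentSpace 𝓘(ℝ, E) x →ₗ[ℝ] _)) (P := (A.P x : TangentSpace 𝓘(ℝ, E) x →ₗ[ℝ] _))
    (A.anticomm x) (A.P_sq x) (b := b) fun i => hb i
  constructor
  · intro hb'
    let g : Matrix.GeneralLinearGroup (Fin n ⊕ Fin n) ℝ :=
      ⟨b.toMatrix b', b'.toMatrix b, b.toMatrix_mul_toMatrix_flip b',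
        b'.toMatrix_mul_toMatrix_flip b⟩
    refine ⟨g, mem_deltaGL_iff.2 (mem_deltaLie_iff_entries.2 fun i j => ?_), fun j =>
      (b.sum_toMatrix_smul_self b' j).symm⟩
    obtain ⟨h1, h2, h3⟩ := hrepr (b' (.inl j)) i
    rw [ContinuousLinearMap.coe_coe, (hb' j).1] at h1
    rw [ContinuousLinearMap.coe_coe, (hb' j).2] at h2 h3
    simp only [g, Basis.toMatrix_apply]
    exact ⟨h3.symm, by linarith, by linarith⟩
  · rintro ⟨g, hg, hgb⟩ j
    have hg := mem_deltaLie_iff_entries.1 (mem_deltaGL_iff.1 hg)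
    have hl : b' (.inl j) = ∑ i, (g : Matrix (Fin n ⊕ Fin n) (Fin n ⊕ Fin n) ℝ) (.inl i) (.inl j) •
        b (.inl i) := by
      rw [hgb, Fintype.sum_sum_type]
      simp [(hg _ _).2.2]
    have hr : b' (.inr j) = ∑ i, (g : Matrix (Fin n ⊕ Fin n) (Fin n ⊕ Fin n) ℝ) (.inl i) (.inl j) •
        b (.inr i) := by
      rw [hgb, Fintype.sum_sum_type]
      simp [(hg _ _).1, (hg _ _).2.1]
    rw [hl, hr, map_sum, map_sum]
    simp only [map_smul, (hb _).1, (hb _).2, and_self]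

variable [FiniteDimensional ℝ E]

theorem AlmostBiparacomplex.exists_localSection (A : AlmostBiparacomplex E M)
    (hE : finrank ℝ E = 2 * n) (x : M) : ∃ U : Set M, IsOpen U ∧ x ∈ U ∧
      ∃ e : Fin n ⊕ Fin n → Π y : M, TangentSpace 𝓘(ℝ, E) y,
        IsLocalSection (A.adaptedFrames n) U e := by
  obtain ⟨b, hb⟩ := exists_basis_of_anticommuting_involutions (V := TangentSpace 𝓘(ℝ, E) x)
    (F := (A.F x : TangentSpace 𝓘(ℝ, E) x →ₗ[ℝ] _)) (P := (A.P x : TangentSpace 𝓘(ℝ, E) x →ₗ[ℝ] _))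
    hE (A.F_sq x) (A.P_sq x) (A.anticomm x)
  let X : Fin n → Π y : M, TangentSpace 𝓘(ℝ, E) y := fun i => FiberBundle.extend E (b (.inl i))
  choose s hs hX using fun i => FiberBundle.exists_contMDiffOn_extend (k := ∞) 𝓘(ℝ, E) E (b (.inl i))
  obtain ⟨U, hUs, hU, hx⟩ := mem_nhds_iff.1 (Filter.iInter_mem.2 hs)
  have hX : ∀ i, CMDiff[U] ∞ (T% (X i)) := fun i =>
    (hX i).mono (hUs.trans (Set.iInter_subset s i))
  -- Projecting by `(1 + F)/2` makes the extended fields fixed by `F` everywhere without changing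
  -- their values at `x`.
  let Y : Fin n → Π y : M, TangentSpace 𝓘(ℝ, E) y := fun i =>
    (1 / 2 : ℝ) • (X i + fun y => A.F y (X i y))
  have hY : ∀ i, CMDiff[U] ∞ (T% (Y i)) := fun i =>
    ((hX i).add_section (A.smooth_F.contMDiffOn.clm_bundle_apply (hX i))).const_smul_section
  have hFY : ∀ i y, A.F y (Y i y) = Y i y := by
    intro i y
    simp [Y, A.F_sq, add_comm]
  let e : Fin n ⊕ Fin n → Π y : M, TangentSpace 𝓘(ℝ, E) y :=
    Sum.elim Y fun i y => A.P y (Y i y)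
  have he : ∀ i, CMDiff[U] ∞ (T% (e i)) := by
    rintro (i | i)
    · exact hY i
    · exact A.smooth_P.contMDiffOn.clm_bundle_apply (hY i)
  have hYx : ∀ i, Y i x = b (.inl i) := by
    intro i
    have h1 : A.F x (b (.inl i)) = b (.inl i) := (hb i).1
    have h2 : X i x = b (.inl i) := FiberBundle.extend_apply_self _ _
    simp only [Y, Pi.smul_apply, Pi.add_apply, h2, h1]
    module
  have hbe : ∀ i, b i = e i x := by
    rintro (i | i)
    · exact (hYx i).symm
    · rw [← (hb i).2]
      exact congrArg (A.P x) (hYx i).symm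
  obtain ⟨w, hwU, hw, hxw, hframe⟩ := exists_isLocalFrameOn hU hx he b hbe
  refine ⟨w, hw, hxw, e, hframe.contMDiffOn, fun y hy => ⟨hframe.toBasisAt hy, fun i => ?_,
    hframe.toBasisAt_coe hy⟩⟩
  simp only [hframe.toBasisAt_coe]
  exact ⟨hFY i y, rfl⟩

theorem AlmostBiparacomplex.isGStructure_adaptedFrames (A : AlmostBiparacomplex E M)
    (hE : finrank ℝ E = 2 * n) : IsGStructure (deltaGL n) (A.adaptedFrames n) where
  orbit x _ hb b' := A.mem_adaptedFrames_iff x hb b'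
  exists_localSection := A.exists_localSection hE

/-! ### The well-adapted connection of a `ΔGL(n, ℝ)`-structure. -/

variable [CompleteSpace E] [T2Space M] {B B' : FrameFamily E M (Fin n ⊕ Fin n)}

theorem IsWellAdapted.torsionTraceZeroAt_deltaLie (hB : IsGStructure (deltaGL n) B)
    {cov : LinearConnection E M} (h : IsWellAdapted (deltaLie n) B cov) (x : M) :
    TorsionTraceZeroAt (deltaLie n) B cov x := by
  obtain ⟨f⟩ := hB.nonempty_adaptedFrame x
  exact h.torsionTraceZeroAt (fun _ hA _ hA' => mul_mem_deltaLie hA hA') hB.toMatrix_mem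
    hB.frames_nonempty f.isOpen f.mem f.isLocalSection

theorem exists_isWellAdapted_deltaLie (hB : IsGStructure (deltaGL n) B) :
    ∃ cov : LinearConnection E M, IsWellAdapted (deltaLie n) B cov ∧
      ∀ cov' : LinearConnection E M, IsWellAdapted (deltaLie n) B cov' →
        ∀ x, ConnectionEqAt cov' cov x := by
  have h𝔤 := firstProlongation_deltaLie (n := n)
  have htr : ∀ A ∈ deltaLie n, Aᵀ ∈ deltaLie n := fun _ hA => transpose_mem_deltaLie hA
  have hmul : ∀ A ∈ deltaLie n, ∀ A' ∈ deltaLie n, A * A' ∈ deltaLie n :=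
    fun _ hA _ hA' => mul_mem_deltaLie hA hA'
  obtain ⟨Λ, hΛ⟩ := exists_linear_solution h𝔤 htr
  let 𝓔 : ∀ x, AdaptedFrame B x := fun x => (hB.nonempty_adaptedFrame x).some
  refine ⟨gluedConnection Λ 𝓔, ⟨contMDiff_gluedConnection hmul hB.toMatrix_mem hΛ h𝔤 htr 𝓔,
    isAdapted_gluedConnection hmul hB.toMatrix_mem hΛ 𝓔, fun S _ hS X _ x =>
      torsionTraceZeroAt_gluedConnection hmul hB.toMatrix_mem hΛ 𝓔 x _ (hS x) _⟩,
    fun cov' h x => ?_⟩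
  exact connectionEqAt_of_torsionTraceZeroAt h𝔤 htr (𝓔 x).isOpen (𝓔 x).mem (𝓔 x).isLocalSection
    h.adapted (isAdapted_gluedConnection hmul hB.toMatrix_mem hΛ 𝓔)
    (h.torsionTraceZeroAt_deltaLie hB x)
    (torsionTraceZeroAt_gluedConnection hmul hB.toMatrix_mem hΛ 𝓔 x)

end DeltaStructures

end

theorem mainTheorem7 (n : ℕ) :
    -- `Δ_*gl(n, ℝ)` is the Lie algebra of `ΔGL(n, ℝ)`
    IsLieAlgebraOf (deltaLie n) (deltaGL n) ∧
    -- its first prolongation vanishes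
    firstProlongation (deltaLie n) = ⊥ ∧
    -- it is invariant under transposition
    (∀ A ∈ deltaLie n, Aᵀ ∈ deltaLie n) ∧
    -- the well-adapted connection exists
    ∀ (M : Type*) [TopologicalSpace M] [ChartedSpace (EuclideanSpace ℝ (Fin (2 * n))) M]
      [IsManifold (𝓡 (2 * n)) ∞ M] [T2Space M] [SecondCountableTopology M],
      -- the adapted frames of an almost biparacomplex structure form a `ΔGL(n, ℝ)`-structure
      (∀ A : AlmostBiparacomplex (EuclideanSpace ℝ (Fin (2 * n))) M,
        IsGStructure (deltaGL n) (A.adaptedFrames n)) ∧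
      -- each `ΔGL(n, ℝ)`-structure has exactly one well-adapted connection
      (∀ B : FrameFamily (EuclideanSpace ℝ (Fin (2 * n))) M (Fin n ⊕ Fin n),
        IsGStructure (deltaGL n) B →
        ∃ cov : LinearConnection (EuclideanSpace ℝ (Fin (2 * n))) M,
          IsWellAdapted (deltaLie n) B cov ∧
          ∀ cov' : LinearConnection (EuclideanSpace ℝ (Fin (2 * n))) M,
            IsWellAdapted (deltaLie n) B cov' → ∀ x, ConnectionEqAt cov' cov x) ∧
      -- at each point it depends only on the first contact of the `ΔGL(n, ℝ)`-structure
      (∀ B B' : FrameFamily (EuclideanSpace ℝ (Fin (2 * n))) M (Fin n ⊕ Fin n),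
        IsGStructure (deltaGL n) B → IsGStructure (deltaGL n) B' →
        ∀ cov cov' : LinearConnection (EuclideanSpace ℝ (Fin (2 * n))) M,
          IsWellAdapted (deltaLie n) B cov → IsWellAdapted (deltaLie n) B' cov' →
          ∀ x, SameFirstContact B B' x → ConnectionEqAt cov cov' x) := by
  refine ⟨isLieAlgebraOf_deltaLie_deltaGL, firstProlongation_deltaLie,
    fun _ hA => transpose_mem_deltaLie hA, ?_⟩
  intro M _ _ _ _ _
  refine ⟨fun A => A.isGStructure_adaptedFrames (by simp),
    fun B hB => exists_isWellAdapted_deltaLie hB, ?_⟩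
  intro B B' hB hB' cov cov' h h' x hBB'
  exact connectionEqAt_of_sameFirstContact firstProlongation_deltaLie
    (fun _ hA => transpose_mem_deltaLie hA) h.adapted h'.adapted
    (h.torsionTraceZeroAt_deltaLie hB x) (h'.torsionTraceZeroAt_deltaLie hB' x) hBB'
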